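/- **Setting.** Consider the linear system $x(t+1)=Ax(t)+Bu(t)$, $\tilde y(t)=Cx(t)+Du(t)+v(t)$ with $u(t)\in\mathbb R^m$, $x(t)\in\mathbb R^n$, $v(t)\in\mathbb V\subseteq\mathbb R^p$; write $y=Cx+Du$ for the noise-free output and $|\cdot|$ for the Euclidean norm. Assume that $(A,B)$ is controllable and $(A,C)$ is detectable, that $\mathbb U\subset\mathbb R^m$ and $\tilde{\mathbb X}\subset\mathbb R^n$ are compact, and that $\tilde{\mathbb X}\subseteq\mathbb X\subseteq\mathbb R^n$, where $\mathbb X$ is the state constraint set of the estimator. The system is called e-UOSS with constants $p_0,r_0\ge 1$, $\eta\in(0,1)$ if for all initial states $x_1,x_2$, all input sequences $\mathbf u$ and all $t\ge0$ the corresponding states and noise-free outputs satisfy $|x(t;x_1,\mathbf u)-x(t;x_2,\mathbf u)|\le p_0|x_1-x_2|\eta^t+\sum_{\tau=1}^{t}r_0\,|y(t-\tau;x_1,\mathbf u)-y(t-\tau;x_2,\mathbf u)|\,\eta^\tau$. *Offline data.* A noise-free trajectory $u^d,x^d,y^d$ of the system over times $0,\dots,N-1$; available are $u^d$, $\tilde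 x^d=x^d+\varepsilon_x^d$ and $\tilde y^d=y^d+\varepsilon_y^d$, where $|\varepsilon_x^d(k)|_\infty\le\bar\varepsilon_x$ and $|\varepsilon_y^d(k)|_\infty\le\bar\varepsilon_y$. Put $\bar\varepsilon^d=\max(\bar\varepsilon_x,\bar\varepsilon_y)$. $H_M(z_{[0,K-1]})$ is the Hankel matrix of depth $M$ of $z(0),\dots,z(K-1)$; $u^d$ is persistently exciting of order $M$ if $\operatorname{rank}H_M(u^d_{[0,N-1]})=mM$. *Estimator.* Given a horizon $L$ and a prior $\hat x(0)$, at each time $t\ge1$ put $M=\min(t,L)$ and minimize $$|\bar x(t-M)-\hat x(t-M)|_P^2\,\rho^M+\sum_{k=1}^{M}|\sigma^y(t-k)|_R^2\,\rho^k+c_{\sigma}\,|\sigma^x|^2+c_\alpha(\bar\varepsilon_x+\bar\varepsilon_y)|\alpha|^2$$ over $\bar x(t-M),\dots,\bar x(t)\in\mathbb X$, $\alpha\in\mathbb R^{N-M}$, $\sigma^y(t-M),\dots,\sigma^y(t-1)$ and $\sigma^x=(\sigma^x(t-M),\dots,\sigma^x(t))$ subject to $H_M(u^d_{[0,N-2]})\alpha=u_{[t-M,t-1]}$,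 $H_M(\tilde y^d_{[0,N-2]})\alpha=\tilde y_{[t-M,t-1]}-\sigma^y$, $H_{M+1}(\tilde x^d_{[0,N-1]})\alpha=\bar x_{[t-M,t]}+\sigma^x$. The estimate $\hat x(t)$ is the last state $\bar x(t)$ of an optimal solution. *pRES.* For a set $E$ of pairs of noise bounds $(\bar\varepsilon_x,\bar\varepsilon_y)\in[0,\infty)^2$, the estimator (for given $L$, $N$, noise-free offline data and weights) is called practically robustly exponentially stable on $E$ if there are $c_1,c_2\ge1$, $\lambda_1,\lambda_2\in(0,1)$ and a class-$\mathcal K$ function $\gamma$ (continuous, strictly increasing on $[0,\infty)$, $\gamma(0)=0$) such that for all $(\bar\varepsilon_x,\bar\varepsilon_y)\in E$, all offline noise within these bounds, all $x_0,\hat x(0)\in\tilde{\mathbb X}$, all inputs with $u(t)\in\mathbb U$ for which $x(0)=x_0$ and $x(t)\in\tilde{\mathbb X}$ for all $t$, all $v$ with $v(t)\in\mathbb V$, all resulting estimates, and all $t\ge0$, $$|x(t)-\hat x(t)|\le c_1|x_0-\hat x(0)|\lambda_1^t+\sum_{\tau=0}^{t}c_2|v(t-\tau)|\lambda_2^\tau+\gamma(\bar\varepsilon^d).$$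 **Theorem.** The system is e-UOSS for some constants $p_0,r_0,\eta$. Let $p_0,r_0,\eta$ be any such constants, let $P,R$ be symmetric positive definite with $\lambda_{\min}(P)\ge p_0$, $\lambda_{\min}(R)\ge r_0$, and let $\eta\le\rho<1$, $c_{\sigma}\ge p_0$. Then there exist $L_{\min}$ and $\delta>0$ such that for every $L>L_{\min}$, every $N$, every noise-free offline trajectory of length $N$ whose input is persistently exciting of order $L+n+1$, and every $c_\alpha\ge\max\{\tfrac{\eta-\eta^{L+1}}{1-\eta}r_0\sqrt p\,(N-1),\,2p_0\sqrt{nN}\}$: 1. the robust data-driven MHE is pRES on the set of all $(\bar\varepsilon_x,\bar\varepsilon_y)$ with $c_\alpha(\bar\varepsilon_x+\bar\varepsilon_y)\rho^L\le\delta$ (i.e. the minimal horizon grows logarithmically with the regularization weight $c_\alpha(\bar\varepsilon_x+\bar\varepsilon_y)$); 2. if $\mathbb X$ is bounded, the robust data-driven MHE is pRES on the set of all $(\bar\varepsilon_x,\bar\varepsilon_y)\in[0,\infty)^2$. -/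

import Mathlib

open Matrix NNReal

noncomputable section

/-- Euclidean space of dimension `q`; its norm is the Euclidean norm `|·|`. -/
abbrev Vec (q : ℕ) : Type := EuclideanSpace ℝ (Fin q)

/-- A discrete-time LTI system `x(t+1) = A x(t) + B u(t)`, `y(t) = C x(t) + D u(t)` with `m` inputs,
`n` states and `p` outputs. -/
structure LinSys (m n p : ℕ) where
  A : Matrix (Fin n) (Fin n) ℝ
  B : Matrix (Fin n) (Fin m) ℝ
  C : Matrix (Fin p) (Fin n) ℝ
  D : Matrix (Fin p) (Fin m) ℝ

namespace LinSys

variable {m n p : ℕ}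

/-- The state `x(t; x₀, u)`. -/
def state (S : LinSys m n p) (x₀ : Vec n) (u : ℕ → Vec m) : ℕ → Vec n
  | 0 => x₀
  | t + 1 => WithLp.toLp 2 (S.A *ᵥ (S.state x₀ u t).ofLp + S.B *ᵥ (u t).ofLp)

/-- The noise-free output `y(t) = h(x(t; x₀, u), u(t)) = C x(t) + D u(t)`. -/
def output (S : LinSys m n p) (x₀ : Vec n) (u : ℕ → Vec m) (t : ℕ) : Vec p :=
  WithLp.toLp 2 (S.C *ᵥ (S.state x₀ u t).ofLp + S.D *ᵥ (u t).ofLp)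

/-- Controllability: the matrix `[B, AB, …, Aⁿ⁻¹B]` has rank `n`. -/
def IsControllable (S : LinSys m n p) : Prop :=
  (Matrix.of fun (i : Fin n) (kj : Fin n × Fin m) => (S.A ^ (kj.1 : ℕ) * S.B) i kj.2).rank = n

/-- Detectability of `(A, C)`: some output injection makes `A + K C` Schur stable, i.e. all its
complex eigenvalues lie in the open unit disc. -/
def IsDetectable (S : LinSys m n p) : Prop :=
  ∃ K : Matrix (Fin n) (Fin p) ℝ,
    ∀ z ∈ spectrum ℂ ((S.A + K * S.C).map (algebraMap ℝ ℂ)), ‖z‖ < 1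

/-- Incremental exponential uniform output-to-state stability with constants `p₀, r₀, η`. -/
def IsEUOSS (S : LinSys m n p) (p₀ r₀ η : ℝ) : Prop :=
  1 ≤ p₀ ∧ 1 ≤ r₀ ∧ 0 < η ∧ η < 1 ∧
    ∀ (x₁ x₂ : Vec n) (u : ℕ → Vec m) (t : ℕ),
      ‖S.state x₁ u t - S.state x₂ u t‖ ≤
        p₀ * ‖x₁ - x₂‖ * η ^ t +
          ∑ τ ∈ Finset.Icc 1 t,
            r₀ * ‖S.output x₁ u (t - τ) - S.output x₂ u (t - τ)‖ * η ^ τ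

end LinSys

/-- The Hankel matrix with `L` block rows and `K` columns of the sequence `z`. The matrix
`H_L(z_[0,N-1])` of depth `L` of a window of length `N` is `hankel L (N + 1 - L) z`. -/
def hankel {q : ℕ} (L K : ℕ) (z : ℕ → Vec q) : Matrix (Fin L × Fin q) (Fin K) ℝ :=
  Matrix.of fun ij k => z ((ij.1 : ℕ) + (k : ℕ)) ij.2

/-- The window `z(s), …, z(s + L - 1)` stacked into one vector. -/
def stack {q : ℕ} (L s : ℕ) (z : ℕ → Vec q) : Fin L × Fin q → ℝ :=
  fun ij => z (s + (ij.1 : ℕ)) ij.2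

/-- Persistency of excitation of order `L` of `u(0), …, u(N-1)`. -/
def IsPersistentlyExciting {m : ℕ} (L N : ℕ) (u : ℕ → Vec m) : Prop :=
  (hankel L (N + 1 - L) u).rank = m * L

/-- `|x|_P²  = xᵀ P x`. -/
def wsq {q : ℕ} (P : Matrix (Fin q) (Fin q) ℝ) (x : Vec q) : ℝ :=
  x.ofLp ⬝ᵥ (P *ᵥ x.ofLp)

/-- The weights of the cost function of the estimator. -/
structure Weights (n p : ℕ) where
  P : Matrix (Fin n) (Fin n) ℝ
  R : Matrix (Fin p) (Fin p) ℝ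
  ρ : ℝ
  cσ : ℝ
  cα : ℝ

/-- The decision variables of the optimization problem with horizon `M` and Hankel matrices with
`K` columns. If the window starts at time `s = t - M`, then index `i` refers to time `s + i`. -/
structure Decision (n p M K : ℕ) where
  xbar : Fin (M + 1) → Vec n
  α : Vec K
  σy : Fin M → Vec p
  σx : Fin (M + 1) → Vec n

section MHE

variable {m n p : ℕ}

/-- The cost: prior weighting, stage costs, and the two regularization terms. The stage cost of the
fitting error at time `t - k` is discounted by `ρ ^ k`. -/
def Weights.cost (W : Weights n p) (εx εy : ℝ≥0) (prior : Vec n) {M K : ℕ}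
    (d : Decision n p M K) : ℝ :=
  wsq W.P (d.xbar 0 - prior) * W.ρ ^ M
    + ∑ i : Fin M, wsq W.R (d.σy i) * W.ρ ^ (M - (i : ℕ))
    + W.cσ * ∑ i : Fin (M + 1), ‖d.σx i‖ ^ 2
    + W.cα * ((εx : ℝ) + (εy : ℝ)) * ‖d.α‖ ^ 2

/-- The constraints of the problem at time `t` with horizon `M`, in terms of the offline input data
`ud`, the (noisy) offline output and state data `yd`, `xd`, the constraint set `X`, and the
online inputs `u` and (noisy) online outputs `y`. -/
def Decision.IsFeasible (ud : ℕ → Vec m) (yd : ℕ → Vec p) (xd : ℕ → Vec n) (X : Set (Vec n))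
    (u : ℕ → Vec m) (y : ℕ → Vec p) (t : ℕ) {M K : ℕ} (d : Decision n p M K) : Prop :=
  hankel M K ud *ᵥ d.α.ofLp = stack M (t - M) u ∧
  hankel M K yd *ᵥ d.α.ofLp = stack M (t - M) y - (fun ij => d.σy ij.1 ij.2) ∧
  hankel (M + 1) K xd *ᵥ d.α.ofLp = (fun ij => d.xbar ij.1 ij.2) + (fun ij => d.σx ij.1 ij.2) ∧
  ∀ i, d.xbar i ∈ X

/-- `xhat` is a sequence of state estimates produced by the robust data-driven moving horizon
estimator with horizon `L` and prior estimate `xhat 0`. At time `t ≥ 1` the problem with horizon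
`M = min t L` is solved (full information for `t < L`, moving horizon for `t ≥ L`) with prior
`xhat (t - M)`, and `xhat t` is the last state of an optimal solution. The Hankel matrices
`H_M(ud_[0,N-2])`, `H_M(yd_[0,N-2])`, `H_{M+1}(xd_[0,N-1])` have `N - M` columns. -/
def IsMHEEstimate (W : Weights n p) (L N : ℕ) (ud : ℕ → Vec m) (yd : ℕ → Vec p)
    (xd : ℕ → Vec n) (εx εy : ℝ≥0) (X : Set (Vec n)) (u : ℕ → Vec m) (y : ℕ → Vec p)
    (xhat : ℕ → Vec n) : Prop :=
  ∀ t, 1 ≤ t → ∃ d : Decision n p (min t L) (N - min t L),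
    d.IsFeasible ud yd xd X u y t ∧
    (∀ d' : Decision n p (min t L) (N - min t L), d'.IsFeasible ud yd xd X u y t →
      W.cost εx εy (xhat (t - min t L)) d ≤ W.cost εx εy (xhat (t - min t L)) d') ∧
    xhat t = d.xbar (Fin.last (min t L))

/-- Functions of class `𝒦`. -/
def IsClassK (γ : ℝ≥0 → ℝ≥0) : Prop :=
  Continuous γ ∧ StrictMono γ ∧ γ 0 = 0

/-- Practical robust exponential stability of the robust data-driven moving horizon estimator, for
all pairs `(ε̄_x, ε̄_y)` of offline noise bounds in `E`. The constants `c₁, c₂, lam₁, lam₂` and the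
function `γ` do not depend on the noise bounds, on the noise, on the initial conditions, or on the
online inputs. The noise-free offline data is the trajectory with inputs `ud` starting in `xd₀`; the
data `y^d + ε_y` and `x^d + ε_x` is what the estimator uses. -/
def IsPRES (S : LinSys m n p) (W : Weights n p) (L N : ℕ) (ud : ℕ → Vec m) (xd₀ : Vec n)
    (U : Set (Vec m)) (Xt X : Set (Vec n)) (V : Set (Vec p)) (E : Set (ℝ≥0 × ℝ≥0)) : Prop :=
  ∃ (c₁ c₂ lam₁ lam₂ : ℝ) (γ : ℝ≥0 → ℝ≥0),
    1 ≤ c₁ ∧ 1 ≤ c₂ ∧ lam₁ ∈ Set.Ioo 0 1 ∧ lam₂ ∈ Set.Ioo 0 1 ∧ IsClassK γ ∧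
    ∀ εx εy : ℝ≥0, (εx, εy) ∈ E →
    ∀ (ex : ℕ → Vec n) (ey : ℕ → Vec p),
      (∀ k < N, ∀ i, |ex k i| ≤ εx) → (∀ k < N, ∀ i, |ey k i| ≤ εy) →
    ∀ (x₀ : Vec n) (u : ℕ → Vec m) (v : ℕ → Vec p) (xhat : ℕ → Vec n),
      x₀ ∈ Xt → xhat 0 ∈ Xt → (∀ t, u t ∈ U) → (∀ t, S.state x₀ u t ∈ Xt) → (∀ t, v t ∈ V) →
      IsMHEEstimate W L N ud (fun k => S.output xd₀ ud k + ey k)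
        (fun k => S.state xd₀ ud k + ex k) εx εy X u (fun t => S.output x₀ u t + v t) xhat →
      ∀ t, ‖S.state x₀ u t - xhat t‖ ≤
        c₁ * ‖x₀ - xhat 0‖ * lam₁ ^ t
          + ∑ τ ∈ Finset.range (t + 1), c₂ * ‖v (t - τ)‖ * lam₂ ^ τ
          + γ (max εx εy)

end MHE

end

/-!
The optimal solution `α` of the estimation problem combines columns of the noise-free data into an
exact trajectory of the system that has the online input. Output-to-state stability compares this
trajectory with the true one over the window. Their outputs and initial states differ by the error
of the prior, the online noise, quantities that the cost penalizes (the slack variables and the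
distance of the initial state to the prior), and offline noise times `α`. Since
`cα ≥ 2 p₀ √(nN)`, the latter is bounded by a multiple of `√q √J`, where `q = cα (ε̄_x + ε̄_y)` and
`J` is the optimal cost, because the cost contains `q |α|²`. So with `lam = √ρ`
(`norm_state_sub_le_of_isFeasible`)

  `|x(t) - x̂(t)| ≤ p₀ lam^M |x(t-M) - x̂(t-M)| + r₀ ∑ |v(t-τ)| lam^τ + c₀ (1 + √q) √J`,

where `c₀` is `costGain`.

Conversely the true trajectory is feasible. By Willems' fundamental lemma it is generated by some
`α`, which is bounded because inputs and states stay in compact sets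
(`LinSys.exists_bounded_combination`). This bounds `√J` by a multiple of
`lam^M |x(t-M) - x̂(t-M)| + ∑ |v(t-τ)| lam^τ` plus a function of the offline noise that vanishes at
zero (`exists_isFeasible_sqrt_cost_le`). Together they give a contraction over a full horizon
as soon as `lam^L` and `√q lam^L = √(q ρ^L)` are small, that is, for `L > Lmin` and `q ρ^L ≤ δ`.
Iterating it gives part 1 (`isPRES_of_contraction`).

For bounded `X`, part 1 covers all small offline noise, and for large offline noise the error is
at most the diameter of `X`, which a linear gain dominates (`IsPRES.univ_of_isBounded`).

Existence of output-to-state stability constants follows from detectability by output injection and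
Gelfand's formula (`LinSys.IsDetectable.exists_isEUOSS`).
-/

noncomputable section

/-! ### Detectability and output-to-state stability -/

open scoped Matrix.Norms.L2Operator in
/-- A real matrix whose complex eigenvalues lie in the open unit disc has exponentially decaying
powers, by Gelfand's formula for its complexification. -/
theorem exists_norm_pow_mulVec_le {n : ℕ} (F : Matrix (Fin n) (Fin n) ℝ)
    (hF : ∀ z ∈ spectrum ℂ (F.map (algebraMap ℝ ℂ)), ‖z‖ < 1) :
    ∃ c η : ℝ, 1 ≤ c ∧ 0 < η ∧ η < 1 ∧ ∀ (t : ℕ) (x : Vec n),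
      ‖(WithLp.toLp 2 (F ^ t *ᵥ x.ofLp) : Vec n)‖ ≤ c * η ^ t * ‖x‖ := by
  rcases isEmpty_or_nonempty (Fin n) with h | h
  · refine ⟨1, 1 / 2, le_rfl, by norm_num, by norm_num, fun t x => ?_⟩
    rw [Subsingleton.elim (WithLp.toLp 2 (F ^ t *ᵥ x.ofLp) : Vec n) 0, norm_zero]
    positivity
  set G : Matrix (Fin n) (Fin n) ℂ := F.map (algebraMap ℝ ℂ) with hG
  have hrad : spectralRadius ℂ G < ((1 : ℝ≥0) : ENNReal) :=
    spectrum.spectralRadius_lt_of_forall_lt G fun z hz => hF z hz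
  obtain ⟨r, hr1, hr2⟩ := ENNReal.lt_iff_exists_nnreal_btwn.1 hrad
  have hr0 : 0 < (r : ℝ) := by
    have : (0 : ENNReal) < r := lt_of_le_of_lt (zero_le) hr1
    exact_mod_cast this
  have hr2' : (r : ℝ) < 1 := by exact_mod_cast hr2
  have hev := (spectrum.pow_nnnorm_pow_one_div_tendsto_nhds_spectralRadius G).eventually_lt_const
    hr1
  obtain ⟨k₀, hk₀⟩ := Filter.eventually_atTop.1 hev
  have hdecay : ∀ k, k₀ + 1 ≤ k → ‖G ^ k‖ ≤ (r : ℝ) ^ k := by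
    intro k hk
    have h1 := (hk₀ k (by omega)).le
    have hk' : (k : ℝ) ≠ 0 := by
      have : k ≠ 0 := by omega
      exact_mod_cast this
    have h2 := ENNReal.rpow_le_rpow h1 (Nat.cast_nonneg (α := ℝ) k)
    rw [← ENNReal.rpow_mul, one_div_mul_cancel hk', ENNReal.rpow_one, ENNReal.rpow_natCast] at h2
    have h3 : ‖G ^ k‖₊ ≤ r ^ k := by exact_mod_cast h2
    exact_mod_cast h3
  have hsum : 0 ≤ ∑ k ∈ Finset.range (k₀ + 1), ‖G ^ k‖ / (r : ℝ) ^ k :=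
    Finset.sum_nonneg fun k _ => by positivity
  have hall : ∀ k, ‖G ^ k‖ ≤
      (1 + ∑ k ∈ Finset.range (k₀ + 1), ‖G ^ k‖ / (r : ℝ) ^ k) * (r : ℝ) ^ k := by
    intro k
    rcases lt_or_ge k (k₀ + 1) with hk | hk
    · have h1 := Finset.single_le_sum (f := fun k => ‖G ^ k‖ / (r : ℝ) ^ k)
        (fun k _ => by positivity) (Finset.mem_range.2 hk)
      have h2 : ‖G ^ k‖ / (r : ℝ) ^ k ≤
          1 + ∑ k ∈ Finset.range (k₀ + 1), ‖G ^ k‖ / (r : ℝ) ^ k := by linarith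
      rwa [div_le_iff₀ (by positivity)] at h2
    · calc ‖G ^ k‖ ≤ 1 * (r : ℝ) ^ k := by rw [one_mul]; exact hdecay k hk
        _ ≤ _ := by gcongr; linarith
  refine ⟨_, r, le_add_of_nonneg_right hsum, hr0, hr2', fun t x => ?_⟩
  have hnorm : ∀ y : Fin n → ℝ, ‖(WithLp.toLp 2 (fun i => (y i : ℂ)) : EuclideanSpace ℂ (Fin n))‖
      = ‖(WithLp.toLp 2 y : Vec n)‖ := by
    intro y
    simp [EuclideanSpace.norm_eq]
  have hpow : G ^ t = (F ^ t).map (algebraMap ℝ ℂ) := by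
    rw [hG, Matrix.map_pow]
  have hmul : (fun i => (((F ^ t *ᵥ x.ofLp) i : ℝ) : ℂ)) = G ^ t *ᵥ fun i => (x.ofLp i : ℂ) := by
    funext i
    rw [hpow]
    exact RingHom.map_mulVec (algebraMap ℝ ℂ) (F ^ t) x.ofLp i
  rw [← hnorm, hmul]
  refine (Matrix.l2_opNorm_mulVec (G ^ t) (WithLp.toLp 2 fun i => (x.ofLp i : ℂ))).trans ?_
  rw [hnorm]
  exact mul_le_mul_of_nonneg_right (hall t) (norm_nonneg _)

/-- A matrix acts on Euclidean vectors as a bounded operator. -/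
theorem exists_norm_mulVec_le {q r : ℕ} (K : Matrix (Fin q) (Fin r) ℝ) :
    ∃ κ : ℝ, 0 ≤ κ ∧ ∀ y : Vec r, ‖(WithLp.toLp 2 (K *ᵥ y.ofLp) : Vec q)‖ ≤ κ * ‖y‖ := by
  refine ⟨‖LinearMap.toContinuousLinearMap (Matrix.toEuclideanLin K)‖, norm_nonneg _, fun y => ?_⟩
  exact (LinearMap.toContinuousLinearMap (Matrix.toEuclideanLin K)).le_opNorm y

namespace LinSys

variable {m n p : ℕ}

/-- The difference of two trajectories with the same input, written through the output injection
`A + K C`. -/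
theorem state_sub_state (S : LinSys m n p) (K : Matrix (Fin n) (Fin p) ℝ) (x₁ x₂ : Vec n)
    (u : ℕ → Vec m) (t : ℕ) :
    (S.state x₁ u t - S.state x₂ u t).ofLp = (S.A + K * S.C) ^ t *ᵥ (x₁ - x₂).ofLp
      - ∑ τ ∈ Finset.range t, (S.A + K * S.C) ^ τ *ᵥ
          (K *ᵥ (S.output x₁ u (t - (τ + 1)) - S.output x₂ u (t - (τ + 1))).ofLp) := by
  induction t with
  | zero => simp [state]
  | succ t ih =>
    have hstep : (S.state x₁ u (t + 1) - S.state x₂ u (t + 1)).ofLp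
        = (S.A + K * S.C) *ᵥ (S.state x₁ u t - S.state x₂ u t).ofLp
          - K *ᵥ (S.output x₁ u t - S.output x₂ u t).ofLp := by
      simp only [state, output, WithLp.ofLp_sub, Matrix.add_mulVec, Matrix.mulVec_sub,
        ← Matrix.mulVec_mulVec, Matrix.mulVec_add]
      abel
    rw [hstep, ih, Finset.sum_range_succ', Matrix.mulVec_sub, Matrix.mulVec_mulVec, ← pow_succ',
      Matrix.mulVec_sum]
    simp only [Matrix.mulVec_mulVec _ (S.A + K * S.C), ← pow_succ', pow_zero, Matrix.one_mulVec,
      Nat.add_sub_add_right, Nat.zero_add, Nat.add_sub_cancel]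
    rw [sub_sub]

/-- Detectability implies incremental output-to-state stability with exponential rates. -/
theorem IsDetectable.exists_isEUOSS {S : LinSys m n p} (h : S.IsDetectable) :
    ∃ p₀ r₀ η : ℝ, S.IsEUOSS p₀ r₀ η := by
  obtain ⟨K, hK⟩ := h
  obtain ⟨c, η, hc, hη0, hη1, hF⟩ := exists_norm_pow_mulVec_le _ hK
  obtain ⟨κ, hκ0, hκ⟩ := exists_norm_mulVec_le K
  have hr : 0 ≤ c * κ / η := by positivity
  refine ⟨c, 1 + c * κ / η, η, hc, by linarith, hη0, hη1, fun x₁ x₂ u t => ?_⟩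
  have hx : S.state x₁ u t - S.state x₂ u t
      = WithLp.toLp 2 ((S.A + K * S.C) ^ t *ᵥ (x₁ - x₂).ofLp)
      - ∑ τ ∈ Finset.range t, WithLp.toLp 2 ((S.A + K * S.C) ^ τ *ᵥ
          (K *ᵥ (S.output x₁ u (t - (τ + 1)) - S.output x₂ u (t - (τ + 1))).ofLp)) := by
    apply (WithLp.equiv 2 (Fin n → ℝ)).injective
    simpa [WithLp.ofLp_sum] using S.state_sub_state K x₁ x₂ u t
  rw [hx]
  refine (norm_sub_le _ _).trans (add_le_add ?_ ((norm_sum_le _ _).trans ?_))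
  · exact (hF t _).trans (le_of_eq (by ring))
  · rw [← Finset.Ico_add_one_right_eq_Icc, Finset.sum_Ico_eq_sum_range]
    refine Finset.sum_le_sum fun τ _ => ?_
    rw [add_comm 1 τ]
    set d := S.output x₁ u (t - (τ + 1)) - S.output x₂ u (t - (τ + 1))
    calc ‖(WithLp.toLp 2 ((S.A + K * S.C) ^ τ *ᵥ (K *ᵥ d.ofLp)) : Vec n)‖
        ≤ c * η ^ τ * ‖(WithLp.toLp 2 (K *ᵥ d.ofLp) : Vec n)‖ :=
          hF τ (WithLp.toLp 2 (K *ᵥ d.ofLp))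
      _ ≤ c * η ^ τ * (κ * ‖d‖) := by gcongr; exact hκ d
      _ = (c * κ / η) * ‖d‖ * η ^ (τ + 1) := by rw [pow_succ]; field_simp
      _ ≤ (1 + c * κ / η) * ‖d‖ * η ^ (τ + 1) := by gcongr; linarith

end LinSys

/-! ### Willems' fundamental lemma -/

theorem eq_zero_of_rank_of_vecMul_eq_zero {ι κ : Type*} [Fintype ι] [Fintype κ] (M : Matrix ι κ ℝ)
    (hM : M.rank = Fintype.card ι) (v : ι → ℝ) (hv : v ᵥ* M = 0) : v = 0 := by
  have hli : LinearIndependent ℝ M.row := by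
    rw [linearIndependent_iff_card_eq_finrank_span, ← hM, Matrix.rank_eq_finrank_span_row]
    rfl
  exact Matrix.vecMul_injective_iff.2 hli (by simpa using hv)

/-- A matrix with trivial left kernel has a right inverse. -/
theorem exists_mul_eq_one_of_vecMul {ι κ : Type*} [Fintype ι] [DecidableEq ι] [Fintype κ]
    (M : Matrix ι κ ℝ) (hM : ∀ v : ι → ℝ, v ᵥ* M = 0 → v = 0) : ∃ G : Matrix κ ι ℝ, M * G = 1 := by
  classical
  have hinj : Function.Injective Mᵀ.mulVec := by
    intro v w hvw
    have : (v - w) ᵥ* M = 0 := by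
      rw [Matrix.sub_vecMul, sub_eq_zero, ← Matrix.mulVec_transpose, ← Matrix.mulVec_transpose]
      exact hvw
    exact sub_eq_zero.1 (hM _ this)
  obtain ⟨g, hg⟩ := LinearMap.exists_leftInverse_of_injective Mᵀ.mulVecLin
    (LinearMap.ker_eq_bot.2 hinj)
  refine ⟨(LinearMap.toMatrix' g)ᵀ, ?_⟩
  have h := congrArg LinearMap.toMatrix' hg
  rw [LinearMap.toMatrix'_comp, LinearMap.toMatrix'_id, ← Matrix.toLin'_apply',
    LinearMap.toMatrix'_toLin'] at h
  rw [← Matrix.transpose_inj, Matrix.transpose_mul, Matrix.transpose_transpose, h,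
    Matrix.transpose_one]

namespace LinSys

variable {m n p : ℕ}

theorem IsControllable.eq_zero {S : LinSys m n p} (h : S.IsControllable) (η : Fin n → ℝ)
    (hη : ∀ k < n, η ᵥ* (S.A ^ k * S.B) = 0) : η = 0 := by
  refine eq_zero_of_rank_of_vecMul_eq_zero _ (by rw [h, Fintype.card_fin]) η ?_
  funext kj
  have := congrFun (hη kj.1 kj.1.2) kj.2
  simpa [Matrix.vecMul, dotProduct] using this

end LinSys

/-- Under persistency of excitation, a linear relation among the shifted inputs is trivial. -/
theorem IsPersistentlyExciting.eq_zero {m L N : ℕ} {u : ℕ → Vec m}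
    (h : IsPersistentlyExciting L N u) (θ : ℕ → Fin m → ℝ)
    (hθ : ∀ k, k < N + 1 - L → ∑ l ∈ Finset.range L, θ l ⬝ᵥ (u (k + l)).ofLp = 0) :
    ∀ l < L, θ l = 0 := by
  have hv := eq_zero_of_rank_of_vecMul_eq_zero (hankel L (N + 1 - L) u)
    (by rw [h, Fintype.card_prod, Fintype.card_fin, Fintype.card_fin, mul_comm])
    (fun ij : Fin L × Fin m => θ ij.1 ij.2) (by
      funext k
      have := hθ k k.2
      rw [Finset.sum_range] at this
      simp only [Matrix.vecMul, dotProduct, Fintype.sum_prod_type, hankel, Matrix.of_apply,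
        Pi.zero_apply] at this ⊢
      simpa only [add_comm] using this)
  intro l hl
  funext j
  exact congrFun hv (⟨l, hl⟩, j)

namespace LinSys

variable {m n p : ℕ}

/-- The row-vector sequence `ηA^{n-1}B, …, ηAB, ηB, ξ 0, ξ 1, …`. Shifting a linear relation
`η x(k) + ∑ ξ l u(k + l) = 0` forward in time by `i` steps and rewriting it in terms of `x(k)`
shifts this sequence by `i` entries. -/
def shiftCoeff (S : LinSys m n p) (η : Fin n → ℝ) (ξ : ℕ → Fin m → ℝ) (j : ℕ) : Fin m → ℝ :=
  if j < n then η ᵥ* (S.A ^ (n - 1 - j) * S.B) else ξ (j - n)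

theorem shifted_relation (S : LinSys m n p) {L N : ℕ} (ud : ℕ → Vec m) (xd₀ : Vec n)
    (η : Fin n → ℝ) (ξ : ℕ → Fin m → ℝ) (hξ : ∀ j, L < j → ξ j = 0)
    (h : ∀ k, k + L < N → η ⬝ᵥ (S.state xd₀ ud k).ofLp
      + ∑ l ∈ Finset.range (L + 1), ξ l ⬝ᵥ (ud (k + l)).ofLp = 0) (i : ℕ) (hi : i ≤ n) :
    ∀ k, k + L + i < N → (η ᵥ* S.A ^ i) ⬝ᵥ (S.state xd₀ ud k).ofLp
      + ∑ l ∈ Finset.range (L + n + 1),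
        S.shiftCoeff η ξ (l + n - i) ⬝ᵥ (ud (k + l)).ofLp = 0 := by
  induction i with
  | zero =>
    intro k hk
    rw [← h k (by omega), pow_zero, Matrix.vecMul_one]
    congr 1
    rw [show L + n + 1 = L + 1 + n by omega, Finset.sum_range_add]
    have : ∑ x ∈ Finset.range n,
        S.shiftCoeff η ξ (L + 1 + x + n - 0) ⬝ᵥ (ud (k + (L + 1 + x))).ofLp = 0 := by
      refine Finset.sum_eq_zero fun x _ => ?_
      rw [shiftCoeff, if_neg (by omega), hξ _ (by omega), zero_dotProduct]
    rw [this, add_zero]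
    refine Finset.sum_congr rfl fun l _ => ?_
    rw [shiftCoeff, if_neg (by omega), Nat.sub_zero, Nat.add_sub_cancel]
  | succ i ih =>
    intro k hk
    have hr := ih (by omega) (k + 1) (by omega)
    rw [Finset.sum_range_succ, show S.shiftCoeff η ξ (L + n + n - i) = 0 by
      rw [shiftCoeff, if_neg (by omega), hξ _ (by omega)], zero_dotProduct, add_zero] at hr
    have h0 : S.shiftCoeff η ξ (0 + n - (i + 1)) = η ᵥ* (S.A ^ i * S.B) := by
      rw [shiftCoeff, if_pos (by omega), show n - 1 - (0 + n - (i + 1)) = i by omega]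
    rw [Finset.sum_range_succ', h0, ← hr]
    have hs : (S.state xd₀ ud (k + 1)).ofLp
        = S.A *ᵥ (S.state xd₀ ud k).ofLp + S.B *ᵥ (ud k).ofLp := rfl
    rw [hs, dotProduct_add, Matrix.dotProduct_mulVec, Matrix.dotProduct_mulVec,
      Matrix.vecMul_vecMul, Matrix.vecMul_vecMul, ← pow_succ, add_zero]
    have : ∀ l ∈ Finset.range (L + n),
        S.shiftCoeff η ξ (l + 1 + n - (i + 1)) ⬝ᵥ (ud (k + (l + 1))).ofLp
        = S.shiftCoeff η ξ (l + n - i) ⬝ᵥ (ud (k + 1 + l)).ofLp := by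
      intro l _
      rw [show l + 1 + n - (i + 1) = l + n - i by omega, show k + (l + 1) = k + 1 + l by omega]
    rw [Finset.sum_congr rfl this]
    ring

/-- The core of Willems' fundamental lemma: for a controllable system and an input that is
persistently exciting of order `L + n + 1`, no nontrivial linear relation between the state and the
next `L + 1` inputs holds along the whole trajectory. By Cayley–Hamilton the shifted relations
combine to one among inputs only, whose coefficients vanish; these form a linear recursion for
`shiftCoeff`, run backwards from zero. -/
theorem relation_trivial {S : LinSys m n p} (hS : S.IsControllable) {L N : ℕ} {ud : ℕ → Vec m}
    (hPE : IsPersistentlyExciting (L + n + 1) N ud) (xd₀ : Vec n)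
    (η : Fin n → ℝ) (ξ : ℕ → Fin m → ℝ) (hξ : ∀ j, L < j → ξ j = 0)
    (h : ∀ k, k + L < N → η ⬝ᵥ (S.state xd₀ ud k).ofLp
      + ∑ l ∈ Finset.range (L + 1), ξ l ⬝ᵥ (ud (k + l)).ofLp = 0) :
    η = 0 ∧ ∀ j, ξ j = 0 := by
  set a := S.A.charpoly.coeff with ha
  have hdeg : S.A.charpoly.natDegree = n := by
    rw [Matrix.charpoly_natDegree_eq_dim, Fintype.card_fin]
  have han : a n = 1 := by
    have := S.A.charpoly_monic.coeff_natDegree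
    rwa [hdeg] at this
  -- Cayley–Hamilton
  have hCH : ∑ i ∈ Finset.range (n + 1), a i • S.A ^ i = 0 := by
    have := Matrix.aeval_self_charpoly S.A
    rwa [Polynomial.aeval_eq_sum_range, hdeg] at this
  have hrec : ∀ l < L + n + 1,
      ∑ i ∈ Finset.range (n + 1), a i • S.shiftCoeff η ξ (l + n - i) = 0 := by
    refine hPE.eq_zero (fun l => ∑ i ∈ Finset.range (n + 1), a i • S.shiftCoeff η ξ (l + n - i)) ?_
    intro k hk
    have hsum : ∑ i ∈ Finset.range (n + 1), a i * ((η ᵥ* S.A ^ i) ⬝ᵥ (S.state xd₀ ud k).ofLp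
        + ∑ l ∈ Finset.range (L + n + 1),
          S.shiftCoeff η ξ (l + n - i) ⬝ᵥ (ud (k + l)).ofLp) = 0 := by
      refine Finset.sum_eq_zero fun i hi => ?_
      rw [Finset.mem_range] at hi
      rw [S.shifted_relation ud xd₀ η ξ hξ h i (by omega) k (by omega), mul_zero]
    simp only [mul_add, Finset.sum_add_distrib, Finset.mul_sum] at hsum
    have hx : ∑ i ∈ Finset.range (n + 1), a i * ((η ᵥ* S.A ^ i) ⬝ᵥ (S.state xd₀ ud k).ofLp)
        = 0 := by
      have h1 : η ⬝ᵥ ((∑ i ∈ Finset.range (n + 1), a i • S.A ^ i) *ᵥ (S.state xd₀ ud k).ofLp)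
          = 0 := by rw [hCH, Matrix.zero_mulVec, dotProduct_zero]
      rw [Matrix.sum_mulVec, dotProduct_sum] at h1
      rw [← h1]
      refine Finset.sum_congr rfl fun i _ => ?_
      rw [Matrix.smul_mulVec, dotProduct_smul, Matrix.dotProduct_mulVec, smul_eq_mul]
    rw [hx, zero_add, Finset.sum_comm] at hsum
    rw [← hsum]
    refine Finset.sum_congr rfl fun l _ => ?_
    rw [sum_dotProduct]
    exact Finset.sum_congr rfl fun i _ => by rw [smul_dotProduct, smul_eq_mul]
  have hθ : ∀ d j, L + n + 1 ≤ j + d → S.shiftCoeff η ξ j = 0 := by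
    intro d
    induction d with
    | zero =>
      intro j hj
      rw [shiftCoeff, if_neg (by omega), hξ _ (by omega)]
    | succ d ih =>
      intro j hj
      rcases lt_or_ge j (L + n + 1) with hjl | hjl
      · have := hrec j hjl
        rw [Finset.sum_range_succ, Nat.add_sub_cancel, han, one_smul] at this
        rw [← this, Finset.sum_eq_zero, zero_add]
        intro i hi
        rw [Finset.mem_range] at hi
        rw [ih (j + n - i) (by omega), smul_zero]
      · exact ih j (by omega)
  have hθ' : ∀ j, S.shiftCoeff η ξ j = 0 := fun j => hθ (L + n + 1) j (by omega)
  refine ⟨hS.eq_zero η fun k hk => ?_, fun j => ?_⟩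
  · have := hθ' (n - 1 - k)
    rwa [shiftCoeff, if_pos (by omega), show n - 1 - (n - 1 - k) = k by omega] at this
  · have := hθ' (j + n)
    rwa [shiftCoeff, if_neg (by omega), Nat.add_sub_cancel] at this

/-- Willems' fundamental lemma with a uniform bound: every initial state and input window of
length `M ≤ L` is reproduced by a combination `α` of the columns of the data matrices, with `α`
bounded as long as the state and the inputs are. -/
theorem exists_bounded_combination {S : LinSys m n p} (hS : S.IsControllable) {L N : ℕ}
    {ud : ℕ → Vec m} (hPE : IsPersistentlyExciting (L + n + 1) N ud) (xd₀ : Vec n) (β : ℝ)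
    {M : ℕ} (hM : M ≤ L) :
    ∃ a : ℝ, ∀ (x : Vec n) (u : ℕ → Vec m) (s : ℕ), ‖x‖ ≤ β → (∀ t, ‖u t‖ ≤ β) →
      ∃ α : Vec (N - M), ‖α‖ ≤ a ∧ hankel M (N - M) ud *ᵥ α.ofLp = stack M s u ∧
        ∑ k : Fin (N - M), α k • S.state xd₀ ud k = x := by
  set W : Matrix ((Fin M × Fin m) ⊕ Fin n) (Fin (N - M)) ℝ :=
    Matrix.fromRows (hankel M (N - M) ud) (Matrix.of fun i k => S.state xd₀ ud k i) with hW
  obtain ⟨G, hG⟩ := exists_mul_eq_one_of_vecMul W (by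
    intro v hv
    set ξ : ℕ → Fin m → ℝ := fun j i => if hj : j < M then v (Sum.inl (⟨j, hj⟩, i)) else 0 with hξ
    have hξ0 : ∀ j, M ≤ j → ξ j = 0 := fun j hj => by
      funext i
      rw [hξ]
      simp only [dif_neg (not_lt.2 hj), Pi.zero_apply]
    have hrel := relation_trivial hS hPE xd₀ (fun i => v (Sum.inr i)) ξ
      (fun j hj => hξ0 j (by omega)) (by
        intro k hk
        have hk' : k < N - M := by omega
        have := congrFun hv ⟨k, hk'⟩
        rw [show L + 1 = M + (L + 1 - M) by omega, Finset.sum_range_add,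
          Finset.sum_eq_zero (s := Finset.range (L + 1 - M))
            (fun l _ => by rw [hξ0 _ (by omega), zero_dotProduct]), add_zero,
          Finset.sum_range, add_comm]
        simp only [Matrix.vecMul, dotProduct, Fintype.sum_sum_type, Fintype.sum_prod_type, hW,
          hankel, Matrix.fromRows_apply_inl, Matrix.fromRows_apply_inr, Matrix.of_apply,
          Pi.zero_apply] at this
        simpa only [hξ, dotProduct, Fin.is_lt, dif_pos, Fin.eta, add_comm k] using this)
    funext i
    rcases i with ⟨j, i⟩ | i
    · have := congrFun (hrel.2 j) i
      simpa only [hξ, Fin.is_lt, dif_pos, Fin.eta, Pi.zero_apply] using this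
    · exact congrFun hrel.1 i)
  obtain ⟨a, ha⟩ := (isCompact_closedBall (0 : (Fin M × Fin m) ⊕ Fin n → ℝ)
    (max β 0)).exists_bound_of_continuousOn
    (f := fun b => (WithLp.toLp 2 (G *ᵥ b) : Vec (N - M)))
    (by
      refine Continuous.continuousOn ?_
      exact (PiLp.continuous_toLp 2 _).comp (Continuous.matrix_mulVec continuous_const
        continuous_id))
  refine ⟨a, fun x u s hx hu => ?_⟩
  set b : (Fin M × Fin m) ⊕ Fin n → ℝ := Sum.elim (stack M s u) x.ofLp with hb
  have hWG : W *ᵥ (G *ᵥ b) = b := by rw [Matrix.mulVec_mulVec, hG, Matrix.one_mulVec]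
  rw [hW, Matrix.fromRows_mulVec] at hWG
  refine ⟨WithLp.toLp 2 (G *ᵥ b), ha b ?_, ?_, ?_⟩
  · rw [mem_closedBall_zero_iff, pi_norm_le_iff_of_nonneg (le_max_right _ _)]
    rintro (⟨j, i⟩ | i)
    · exact ((PiLp.norm_apply_le (u (s + j)) i).trans (hu _)).trans (le_max_left _ _)
    · exact ((PiLp.norm_apply_le x i).trans hx).trans (le_max_left _ _)
  · funext i
    exact congrFun hWG (Sum.inl i)
  · ext i
    have := congrFun hWG (Sum.inr i)
    have hbi : b (Sum.inr i) = x i := rfl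
    simp only [Sum.elim_inr, hbi] at this
    rw [← this]
    simp only [Matrix.mulVec, dotProduct, Matrix.of_apply, WithLp.ofLp_sum, WithLp.ofLp_smul,
      Finset.sum_apply, Pi.smul_apply, smul_eq_mul]
    exact Finset.sum_congr rfl fun k _ => mul_comm _ _

end LinSys

/-! ### Quadratic forms, Hankel combinations and the cost -/

theorem wsq_eq_inner {q : ℕ} (P : Matrix (Fin q) (Fin q) ℝ) (x : Vec q) :
    wsq P x = inner ℝ x (WithLp.toLp 2 (P *ᵥ x.ofLp) : Vec q) := by
  rw [EuclideanSpace.inner_eq_star_dotProduct, wsq, dotProduct_comm]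
  simp

theorem exists_wsq_le {q : ℕ} (P : Matrix (Fin q) (Fin q) ℝ) :
    ∃ c : ℝ, 0 ≤ c ∧ ∀ x : Vec q, wsq P x ≤ c ^ 2 * ‖x‖ ^ 2 := by
  obtain ⟨κ, hκ0, hκ⟩ := exists_norm_mulVec_le P
  refine ⟨√κ, Real.sqrt_nonneg _, fun x => ?_⟩
  rw [Real.sq_sqrt hκ0, wsq_eq_inner]
  calc _ ≤ ‖x‖ * ‖(WithLp.toLp 2 (P *ᵥ x.ofLp) : Vec q)‖ := real_inner_le_norm _ _
    _ ≤ ‖x‖ * (κ * ‖x‖) := by gcongr; exact hκ x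
    _ = κ * ‖x‖ ^ 2 := by ring

/-- A lower bound on the eigenvalues bounds the quadratic form from below, by expansion in an
orthonormal basis of eigenvectors. -/
theorem le_wsq {q : ℕ} {P : Matrix (Fin q) (Fin q) ℝ} (hP : P.IsHermitian) {c : ℝ}
    (hc : ∀ i, c ≤ hP.eigenvalues i) (x : Vec q) : c * ‖x‖ ^ 2 ≤ wsq P x := by
  set b := hP.eigenvectorBasis with hb
  have hself : ∀ i, inner ℝ (b i) (WithLp.toLp 2 (P *ᵥ x.ofLp) : Vec q)
      = hP.eigenvalues i * inner ℝ (b i) x := by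
    intro i
    have h1 := hP.mulVec_eigenvectorBasis i
    have hPt : Pᵀ = P := by simpa using hP.eq
    rw [EuclideanSpace.inner_eq_star_dotProduct, EuclideanSpace.inner_eq_star_dotProduct]
    simp only [star_trivial]
    rw [dotProduct_comm, Matrix.dotProduct_mulVec, ← Matrix.mulVec_transpose, hPt, h1,
      smul_dotProduct, smul_eq_mul, dotProduct_comm]
  rw [wsq_eq_inner, ← b.sum_inner_mul_inner, ← real_inner_self_eq_norm_sq,
    ← b.sum_inner_mul_inner, Finset.mul_sum]
  refine Finset.sum_le_sum fun i _ => ?_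
  rw [hself, real_inner_comm]
  nlinarith [hc i, mul_self_nonneg (inner ℝ (b i) x)]

/-- The linear combination of the shifted windows of `z` with coefficients `α`, evaluated at
time `i`: the `i`-th block of a Hankel matrix of `z` times `α`. -/
def hankelComb {q K : ℕ} (α : Vec K) (z : ℕ → Vec q) (i : ℕ) : Vec q :=
  ∑ k : Fin K, α k • z (i + k)

theorem hankel_mulVec_apply {q M K : ℕ} (α : Vec K) (z : ℕ → Vec q) (i : Fin M) (j : Fin q) :
    (hankel M K z *ᵥ α.ofLp) (i, j) = hankelComb α z i j := by
  simp [hankel, hankelComb, Matrix.mulVec, dotProduct, mul_comm]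

theorem hankelComb_add {q K : ℕ} (α : Vec K) (z w : ℕ → Vec q) (i : ℕ) :
    hankelComb α (fun k => z k + w k) i = hankelComb α z i + hankelComb α w i := by
  simp [hankelComb, Finset.sum_add_distrib]

theorem norm_hankelComb_le {q K N : ℕ} (α : Vec K) (e : ℕ → Vec q) {ε : ℝ} (hε : 0 ≤ ε)
    (he : ∀ k < N, ∀ i, |e k i| ≤ ε) {i : ℕ} (hi : i + K ≤ N) :
    ‖hankelComb α e i‖ ≤ √q * √N * ε * ‖α‖ := by
  have hek : ∀ k : Fin K, ‖e (i + k)‖ ≤ √q * ε := by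
    intro k
    rw [EuclideanSpace.norm_eq, ← Real.sqrt_sq hε, ← Real.sqrt_mul (Nat.cast_nonneg _)]
    refine Real.sqrt_le_sqrt ?_
    calc ∑ j, ‖e (i + k) j‖ ^ 2 ≤ ∑ _j : Fin q, ε ^ 2 := by
          refine Finset.sum_le_sum fun j _ => ?_
          exact pow_le_pow_left₀ (norm_nonneg _) (he _ (by omega) j) 2
      _ = q * ε ^ 2 := by simp
  have hα : ∑ k : Fin K, ‖α k‖ ≤ √N * ‖α‖ := by
    rw [EuclideanSpace.norm_eq, ← Real.sqrt_mul (Nat.cast_nonneg _)]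
    refine Real.le_sqrt_of_sq_le ?_
    have h1 := sq_sum_le_card_mul_sum_sq (s := Finset.univ) (f := fun k : Fin K => ‖α k‖)
    rw [Finset.card_univ, Fintype.card_fin] at h1
    refine h1.trans ?_
    have : (K : ℝ) ≤ N := by exact_mod_cast (by omega : K ≤ N)
    gcongr
  calc ‖hankelComb α e i‖ ≤ ∑ k : Fin K, ‖α k • e (i + k)‖ := norm_sum_le _ _
    _ ≤ ∑ k : Fin K, ‖α k‖ * (√q * ε) := by
        refine Finset.sum_le_sum fun k _ => ?_
        rw [norm_smul]
        gcongr
        exact hek k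
    _ = (∑ k : Fin K, ‖α k‖) * (√q * ε) := by rw [Finset.sum_mul]
    _ ≤ (√N * ‖α‖) * (√q * ε) := by gcongr
    _ = _ := by ring

namespace LinSys

variable {m n p : ℕ}

theorem state_add (S : LinSys m n p) (x₀ : Vec n) (u : ℕ → Vec m) (s i : ℕ) :
    S.state x₀ u (s + i) = S.state (S.state x₀ u s) (fun j => u (s + j)) i := by
  induction i with
  | zero => rfl
  | succ i ih => rw [← add_assoc, state, state, ih]

theorem output_add (S : LinSys m n p) (x₀ : Vec n) (u : ℕ → Vec m) (s i : ℕ) :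
    S.output x₀ u (s + i) = S.output (S.state x₀ u s) (fun j => u (s + j)) i := by
  rw [output, output, state_add]

/-- Linear combinations of windows of a trajectory are trajectories. -/
theorem state_hankelComb (S : LinSys m n p) {K M : ℕ} (α : Vec K) (ud w : ℕ → Vec m)
    (xd₀ : Vec n) (hw : ∀ i < M, hankelComb α ud i = w i) :
    ∀ i ≤ M, S.state (hankelComb α (S.state xd₀ ud) 0) w i = hankelComb α (S.state xd₀ ud) i := by
  intro i
  induction i with
  | zero => intro _; rfl
  | succ i ih =>
    intro hi
    rw [state, ih (by omega), ← hw i (by omega)]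
    apply (WithLp.equiv 2 (Fin n → ℝ)).injective
    simp only [WithLp.equiv_apply, hankelComb, WithLp.ofLp_sum, WithLp.ofLp_smul, Matrix.mulVec_sum,
      Matrix.mulVec_smul]
    rw [← Finset.sum_add_distrib]
    refine Finset.sum_congr rfl fun k _ => ?_
    rw [show i + 1 + (k : ℕ) = i + k + 1 by omega, state, ← smul_add]

theorem output_hankelComb (S : LinSys m n p) {K M : ℕ} (α : Vec K) (ud w : ℕ → Vec m)
    (xd₀ : Vec n) (hw : ∀ i < M, hankelComb α ud i = w i) (i : ℕ) (hi : i < M) :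
    S.output (hankelComb α (S.state xd₀ ud) 0) w i = hankelComb α (S.output xd₀ ud) i := by
  rw [output, S.state_hankelComb α ud w xd₀ hw i hi.le, ← hw i hi]
  apply (WithLp.equiv 2 (Fin p → ℝ)).injective
  simp only [WithLp.equiv_apply, hankelComb, WithLp.ofLp_sum, WithLp.ofLp_smul, Matrix.mulVec_sum,
    Matrix.mulVec_smul, output]
  rw [← Finset.sum_add_distrib]
  exact Finset.sum_congr rfl fun k _ => by rw [← smul_add]

end LinSys

/-- Feasibility in terms of vectors instead of stacked coordinates. -/
theorem Decision.isFeasible_iff {m n p M K t : ℕ} {ud : ℕ → Vec m} {yd : ℕ → Vec p}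
    {xd : ℕ → Vec n} {X : Set (Vec n)} {u : ℕ → Vec m} {y : ℕ → Vec p} (d : Decision n p M K) :
    d.IsFeasible ud yd xd X u y t ↔
      (∀ i : Fin M, hankelComb d.α ud i = u (t - M + i)) ∧
      (∀ i : Fin M, hankelComb d.α yd i = y (t - M + i) - d.σy i) ∧
      (∀ i : Fin (M + 1), hankelComb d.α xd i = d.xbar i + d.σx i) ∧ ∀ i, d.xbar i ∈ X := by
  have h1 : hankel M K ud *ᵥ d.α.ofLp = stack M (t - M) u ↔
      ∀ i : Fin M, hankelComb d.α ud i = u (t - M + i) := by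
    constructor
    · intro h i
      ext j
      rw [← hankel_mulVec_apply, h]
      rfl
    · intro h
      funext ⟨i, j⟩
      rw [hankel_mulVec_apply, h]
      rfl
  have h2 : hankel M K yd *ᵥ d.α.ofLp = stack M (t - M) y - (fun ij => d.σy ij.1 ij.2) ↔
      ∀ i : Fin M, hankelComb d.α yd i = y (t - M + i) - d.σy i := by
    constructor
    · intro h i
      ext j
      rw [← hankel_mulVec_apply, h]
      rfl
    · intro h
      funext ⟨i, j⟩
      rw [hankel_mulVec_apply, h]
      rfl
  have h3 : hankel (M + 1) K xd *ᵥ d.α.ofLp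
        = (fun ij => d.xbar ij.1 ij.2) + (fun ij => d.σx ij.1 ij.2) ↔
      ∀ i : Fin (M + 1), hankelComb d.α xd i = d.xbar i + d.σx i := by
    constructor
    · intro h i
      ext j
      rw [← hankel_mulVec_apply, h]
      rfl
    · intro h
      funext ⟨i, j⟩
      rw [hankel_mulVec_apply, h]
      rfl
  rw [Decision.IsFeasible, h1, h2, h3]

/-- Reindexing of the stage costs by their distance to the end of the window. -/
theorem sum_fin_reflect (M : ℕ) (g : ℕ → ℝ) :
    ∑ i : Fin M, g (M - i) = ∑ τ ∈ Finset.Icc 1 M, g τ := by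
  rw [← Finset.sum_range (fun i => g (M - i)), ← Finset.Ico_add_one_right_eq_Icc,
    Finset.sum_Ico_eq_sum_range, ← Finset.sum_range_reflect]
  refine Finset.sum_congr rfl fun i hi => ?_
  rw [Finset.mem_range] at hi
  congr 1
  omega

theorem sum_pow_le_inv {lam : ℝ} (h0 : 0 ≤ lam) (h1 : lam < 1) (s : Finset ℕ) :
    ∑ τ ∈ s, lam ^ τ ≤ 1 / (1 - lam) := by
  rw [one_div, ← tsum_geometric_of_lt_one h0 h1]
  exact (summable_geometric_of_lt_one h0 h1).sum_le_tsum s fun i _ => pow_nonneg h0 i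

section Cost

variable {n p M K : ℕ} {W : Weights n p} {lam : ℝ}

/-- Each term of the cost is bounded by the cost; the discount `ρ` enters through its square
root `lam`. -/
theorem Weights.le_sqrt_cost (hρ : W.ρ = lam ^ 2)
    (hP : ∀ x, ‖x‖ ^ 2 ≤ wsq W.P x) (hR : ∀ x, ‖x‖ ^ 2 ≤ wsq W.R x) (hσ : 1 ≤ W.cσ)
    (hα : 0 ≤ W.cα) (εx εy : ℝ≥0) (prior : Vec n) (d : Decision n p M K) :
    ‖d.xbar 0 - prior‖ * lam ^ M ≤ √(W.cost εx εy prior d) ∧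
    (∀ i, ‖d.σy i‖ * lam ^ (M - (i : ℕ)) ≤ √(W.cost εx εy prior d)) ∧
    (∀ i, ‖d.σx i‖ ≤ √(W.cost εx εy prior d)) ∧
    √(W.cα * ((εx : ℝ) + εy)) * ‖d.α‖ ≤ √(W.cost εx εy prior d) := by
  have hP0 : ∀ x, 0 ≤ wsq W.P x := fun x => (sq_nonneg _).trans (hP x)
  have hR0 : ∀ x, 0 ≤ wsq W.R x := fun x => (sq_nonneg _).trans (hR x)
  have hq : 0 ≤ W.cα * ((εx : ℝ) + εy) := by positivity
  have hpow : ∀ k, W.ρ ^ k = (lam ^ k) ^ 2 := fun k => by rw [hρ, ← pow_mul, ← pow_mul, mul_comm]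
  have t1 : 0 ≤ wsq W.P (d.xbar 0 - prior) * W.ρ ^ M := by
    rw [hpow]; exact mul_nonneg (hP0 _) (sq_nonneg _)
  have t2' : ∀ i ∈ (Finset.univ : Finset (Fin M)), 0 ≤ wsq W.R (d.σy i) * W.ρ ^ (M - (i : ℕ)) :=
    fun i _ => by rw [hpow]; exact mul_nonneg (hR0 _) (sq_nonneg _)
  have t2 := Finset.sum_nonneg t2'
  have t3' : 0 ≤ ∑ i : Fin (M + 1), ‖d.σx i‖ ^ 2 := Finset.sum_nonneg fun i _ => sq_nonneg _
  have t3 : ∑ i : Fin (M + 1), ‖d.σx i‖ ^ 2 ≤ W.cσ * ∑ i : Fin (M + 1), ‖d.σx i‖ ^ 2 :=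
    le_mul_of_one_le_left t3' hσ
  have t4 : 0 ≤ W.cα * ((εx : ℝ) + εy) * ‖d.α‖ ^ 2 := mul_nonneg hq (sq_nonneg _)
  refine ⟨Real.le_sqrt_of_sq_le ?_, fun i => Real.le_sqrt_of_sq_le ?_,
    fun i => Real.le_sqrt_of_sq_le ?_, Real.le_sqrt_of_sq_le ?_⟩
  · rw [mul_pow, ← hpow, Weights.cost]
    have : ‖d.xbar 0 - prior‖ ^ 2 * W.ρ ^ M ≤ wsq W.P (d.xbar 0 - prior) * W.ρ ^ M := by
      rw [hpow]; exact mul_le_mul_of_nonneg_right (hP _) (sq_nonneg _)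
    linarith
  · rw [mul_pow, ← hpow, Weights.cost]
    have h1 : ‖d.σy i‖ ^ 2 * W.ρ ^ (M - (i : ℕ)) ≤ wsq W.R (d.σy i) * W.ρ ^ (M - (i : ℕ)) := by
      rw [hpow]; exact mul_le_mul_of_nonneg_right (hR _) (sq_nonneg _)
    have h2 := Finset.single_le_sum t2' (Finset.mem_univ i)
    linarith
  · rw [Weights.cost]
    have h2 := Finset.single_le_sum (f := fun i : Fin (M + 1) => ‖d.σx i‖ ^ 2)
      (fun i _ => sq_nonneg _) (Finset.mem_univ i)
    linarith
  · rw [mul_pow, Real.sq_sqrt hq, Weights.cost]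
    linarith

/-- The square root of the cost is at most the sum of the square roots of its terms. -/
theorem Weights.sqrt_cost_le (hlam : 0 < lam) (hρ : W.ρ = lam ^ 2) {cP cR : ℝ} (hcP : 0 ≤ cP)
    (hcR : 0 ≤ cR) (hP : ∀ x, wsq W.P x ≤ cP ^ 2 * ‖x‖ ^ 2)
    (hR : ∀ x, wsq W.R x ≤ cR ^ 2 * ‖x‖ ^ 2) (hσ : 0 ≤ W.cσ)
    (hα : 0 ≤ W.cα) (εx εy : ℝ≥0) (prior : Vec n) (d : Decision n p M K) :
    √(W.cost εx εy prior d) ≤ cP * ‖d.xbar 0 - prior‖ * lam ^ M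
      + cR * ∑ i : Fin M, ‖d.σy i‖ * lam ^ (M - (i : ℕ))
      + √W.cσ * ∑ i : Fin (M + 1), ‖d.σx i‖
      + √(W.cα * ((εx : ℝ) + εy)) * ‖d.α‖ := by
  have hq : 0 ≤ W.cα * ((εx : ℝ) + εy) := by positivity
  have hpow : ∀ k, W.ρ ^ k = (lam ^ k) ^ 2 := fun k => by rw [hρ, ← pow_mul, ← pow_mul, mul_comm]
  have a1 : 0 ≤ cP * ‖d.xbar 0 - prior‖ * lam ^ M := by positivity
  have a2 : 0 ≤ cR * ∑ i : Fin M, ‖d.σy i‖ * lam ^ (M - (i : ℕ)) :=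
    mul_nonneg hcR (Finset.sum_nonneg fun i _ => by positivity)
  have a3 : 0 ≤ √W.cσ * ∑ i : Fin (M + 1), ‖d.σx i‖ :=
    mul_nonneg (Real.sqrt_nonneg _) (Finset.sum_nonneg fun i _ => by positivity)
  have a4 : 0 ≤ √(W.cα * ((εx : ℝ) + εy)) * ‖d.α‖ := by positivity
  have b1 : wsq W.P (d.xbar 0 - prior) * W.ρ ^ M
      ≤ (cP * ‖d.xbar 0 - prior‖ * lam ^ M) ^ 2 := by
    rw [hpow, mul_pow, mul_pow]
    exact mul_le_mul_of_nonneg_right (hP _) (sq_nonneg _)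
  have b2 : ∑ i : Fin M, wsq W.R (d.σy i) * W.ρ ^ (M - (i : ℕ))
      ≤ (cR * ∑ i : Fin M, ‖d.σy i‖ * lam ^ (M - (i : ℕ))) ^ 2 := by
    rw [mul_pow]
    refine le_trans ?_ (mul_le_mul_of_nonneg_left
      (Finset.sum_sq_le_sq_sum_of_nonneg fun i _ => by positivity) (sq_nonneg cR))
    rw [Finset.mul_sum]
    refine Finset.sum_le_sum fun i _ => ?_
    rw [hpow, mul_pow, ← mul_assoc]
    exact mul_le_mul_of_nonneg_right (hR _) (sq_nonneg _)
  have b3 : W.cσ * ∑ i : Fin (M + 1), ‖d.σx i‖ ^ 2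
      ≤ (√W.cσ * ∑ i : Fin (M + 1), ‖d.σx i‖) ^ 2 := by
    rw [mul_pow, Real.sq_sqrt hσ]
    exact mul_le_mul_of_nonneg_left (Finset.sum_sq_le_sq_sum_of_nonneg fun i _ => by positivity) hσ
  have b4 : W.cα * ((εx : ℝ) + εy) * ‖d.α‖ ^ 2
      = (√(W.cα * ((εx : ℝ) + εy)) * ‖d.α‖) ^ 2 := by
    rw [mul_pow, Real.sq_sqrt hq]
  rw [Real.sqrt_le_left (by positivity), Weights.cost]
  nlinarith [mul_nonneg a1 a2, mul_nonneg a1 a3, mul_nonneg a1 a4, mul_nonneg a2 a3,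
    mul_nonneg a2 a4, mul_nonneg a3 a4]

end Cost

/-! ### Error and cost over one window -/

/-- Constant that multiplies the square root of the cost in the bound on the estimation error. -/
def costGain (p : ℕ) (p₀ r₀ lam : ℝ) : ℝ := 2 * p₀ + 1 + r₀ * (1 + √p) / (1 - lam)

section OneStep

variable {m n p : ℕ} {S : LinSys m n p} {W : Weights n p} {lam : ℝ}

/-- The error of any feasible decision in terms of the prior error, the online noise, and the cost
of the decision. The decision variable `α` defines an exact trajectory with the same input, to which
output-to-state stability applies; it differs from `xbar` by slack and by offline noise times `α`,
which the regularization of `α` in the cost controls. -/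
theorem norm_state_sub_le_of_isFeasible {p₀ r₀ η : ℝ} (hE : S.IsEUOSS p₀ r₀ η)
    (hlam0 : 0 < lam) (hlam1 : lam < 1) (hρ : W.ρ = lam ^ 2) (hη : η ≤ W.ρ)
    (hP : ∀ x, ‖x‖ ^ 2 ≤ wsq W.P x) (hR : ∀ x, ‖x‖ ^ 2 ≤ wsq W.R x) (hσ : 1 ≤ W.cσ)
    {N : ℕ} (hn : 0 < n) (hα : √n * √N ≤ W.cα)
    {ud : ℕ → Vec m} {xd₀ : Vec n} {X : Set (Vec n)} {εx εy : ℝ≥0} {ex : ℕ → Vec n}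
    {ey : ℕ → Vec p} (hex : ∀ k < N, ∀ i, |ex k i| ≤ εx) (hey : ∀ k < N, ∀ i, |ey k i| ≤ εy)
    {x₀ : Vec n} {u : ℕ → Vec m} {v : ℕ → Vec p} {t M K : ℕ} (hMt : M ≤ t) (hMK : M + K ≤ N)
    (prior : Vec n) (d : Decision n p M K)
    (hd : d.IsFeasible ud (fun k => S.output xd₀ ud k + ey k)
      (fun k => S.state xd₀ ud k + ex k) X u (fun t => S.output x₀ u t + v t) t) :
    ‖S.state x₀ u t - d.xbar (Fin.last M)‖ ≤
      p₀ * lam ^ M * ‖S.state x₀ u (t - M) - prior‖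
        + r₀ * ∑ τ ∈ Finset.Icc 1 M, ‖v (t - τ)‖ * lam ^ τ
        + costGain p p₀ r₀ lam * (1 + √(W.cα * ((εx : ℝ) + εy))) * √(W.cost εx εy prior d) := by
  obtain ⟨hp₀, hr₀, hη0, hη1, hE⟩ := hE
  rw [Decision.isFeasible_iff] at hd
  obtain ⟨hdu, hdy, hdx, -⟩ := hd
  have hα0 : 0 ≤ W.cα := le_trans (by positivity) hα
  have hNα : √N ≤ W.cα := by
    refine le_trans (le_mul_of_one_le_left (Real.sqrt_nonneg _) ?_) hα
    rw [Real.one_le_sqrt]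
    exact_mod_cast hn
  obtain ⟨hJ1, hJ2, hJ3, hJ4⟩ := W.le_sqrt_cost hρ hP hR hσ hα0 εx εy prior d
  set J := √(W.cost εx εy prior d) with hJ
  set q := W.cα * ((εx : ℝ) + εy) with hq
  have hq0 : 0 ≤ q := by positivity
  have hJ0 : 0 ≤ J := Real.sqrt_nonneg _
  have hqα : q * ‖d.α‖ ≤ √q * J := by
    nth_rewrite 1 [← Real.mul_self_sqrt hq0]
    rw [mul_assoc]
    gcongr
  have hex' : ∀ i ≤ M, ‖hankelComb d.α ex i‖ ≤ √q * J := by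
    intro i hi
    refine (norm_hankelComb_le d.α ex εx.2 hex (by omega)).trans (le_trans ?_ hqα)
    have : √n * √N * (εx : ℝ) ≤ q := by
      rw [hq]
      have : (0 : ℝ) ≤ εy := εy.2
      exact mul_le_mul hα (by linarith) εx.2 hα0
    gcongr
    exact this
  have hey' : ∀ i ≤ M, ‖hankelComb d.α ey i‖ ≤ √p * (√q * J) := by
    intro i hi
    refine (norm_hankelComb_le d.α ey εy.2 hey (by omega)).trans
      (le_trans ?_ (mul_le_mul_of_nonneg_left hqα (Real.sqrt_nonneg _)))
    have : √N * (εy : ℝ) ≤ q := by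
      rw [hq]
      have : (0 : ℝ) ≤ εx := εx.2
      exact mul_le_mul hNα (by linarith) εy.2 hα0
    calc √p * √N * (εy : ℝ) * ‖d.α‖ = √p * ((√N * (εy : ℝ)) * ‖d.α‖) := by ring
      _ ≤ _ := by gcongr
  -- the exact trajectory generated by `α`
  set s := t - M with hs
  have hts : t = s + M := by omega
  set w : ℕ → Vec m := fun j => u (s + j) with hw
  set z := hankelComb d.α (S.state xd₀ ud) with hz
  have hwin : ∀ i < M, hankelComb d.α ud i = w i := fun i hi => hdu ⟨i, hi⟩
  have hzs := S.state_hankelComb d.α ud w xd₀ hwin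
  have hzy := S.output_hankelComb d.α ud w xd₀ hwin
  rw [← hz] at hzs hzy
  have hzx : ∀ i : Fin (M + 1), z i = d.xbar i + d.σx i - hankelComb d.α ex i := by
    intro i
    rw [← hdx i, hankelComb_add, add_sub_cancel_right]
  have hyy : ∀ i : Fin M, S.output x₀ u (s + i) - hankelComb d.α (S.output xd₀ ud) i
      = d.σy i + hankelComb d.α ey i - v (s + i) := by
    intro i
    have := hdy i
    rw [hankelComb_add] at this
    rw [eq_sub_of_add_eq this]
    abel
  have hηlam : ∀ τ, η ^ τ ≤ lam ^ τ * lam ^ τ := by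
    intro τ
    rw [← mul_pow, ← sq]
    exact pow_le_pow_left₀ hη0.le (hη.trans hρ.le) τ
  have hlamτ : ∀ τ, lam ^ τ ≤ 1 := fun τ => pow_le_one₀ hlam0.le hlam1.le
  have hηlam' : ∀ τ, η ^ τ ≤ lam ^ τ := fun τ =>
    (hηlam τ).trans (mul_le_of_le_one_left (by positivity) (hlamτ τ))
  have main := hE (S.state x₀ u s) (z 0) w M
  rw [← S.state_add, hzs M le_rfl, ← hts] at main
  -- the contribution of the initial states of the two trajectories
  have hinit : ‖S.state x₀ u s - z 0‖ * η ^ M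
      ≤ lam ^ M * ‖S.state x₀ u s - prior‖ + (2 + √q) * J := by
    have h0 : S.state x₀ u s - z 0 = (S.state x₀ u s - prior) - (d.xbar 0 - prior) - d.σx 0
        + hankelComb d.α ex 0 := by
      have := hzx 0
      rw [Fin.val_zero] at this
      rw [this]
      abel
    have h1 : ‖S.state x₀ u s - z 0‖ ≤ ‖S.state x₀ u s - prior‖ + ‖d.xbar 0 - prior‖ + ‖d.σx 0‖
        + ‖hankelComb d.α ex 0‖ := by
      rw [h0]
      refine (norm_add_le _ _).trans (add_le_add_left ((norm_sub_le _ _).trans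
        (add_le_add_left (norm_sub_le _ _) _)) _)
    have h2 := hex' 0 (Nat.zero_le _)
    have h3 := hJ3 0
    calc ‖S.state x₀ u s - z 0‖ * η ^ M
        ≤ (‖S.state x₀ u s - prior‖ + ‖d.xbar 0 - prior‖ + ‖d.σx 0‖
            + ‖hankelComb d.α ex 0‖) * lam ^ M := mul_le_mul h1 (hηlam' M) (by positivity)
              (by positivity)
      _ = lam ^ M * ‖S.state x₀ u s - prior‖ + (‖d.xbar 0 - prior‖ * lam ^ M)
          + (‖d.σx 0‖ + ‖hankelComb d.α ex 0‖) * lam ^ M := by ring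
      _ ≤ lam ^ M * ‖S.state x₀ u s - prior‖ + J + (‖d.σx 0‖ + ‖hankelComb d.α ex 0‖) * 1 := by
          gcongr
          exact hlamτ M
      _ ≤ _ := by linarith
  -- the contribution of the outputs
  have hout : ∑ τ ∈ Finset.Icc 1 M,
      r₀ * ‖S.output (S.state x₀ u s) w (M - τ) - S.output (z 0) w (M - τ)‖ * η ^ τ
      ≤ r₀ * ∑ τ ∈ Finset.Icc 1 M, ‖v (t - τ)‖ * lam ^ τ
        + r₀ * (1 + √p * √q) * J * (1 / (1 - lam)) := by
    have hc : 0 ≤ r₀ * (1 + √p * √q) * J := by positivity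
    refine le_trans ?_ (add_le_add_right (mul_le_mul_of_nonneg_left
      (sum_pow_le_inv hlam0.le hlam1 (Finset.Icc 1 M)) hc) _)
    rw [Finset.mul_sum, Finset.mul_sum, ← Finset.sum_add_distrib]
    refine Finset.sum_le_sum fun τ hτ => ?_
    rw [Finset.mem_Icc] at hτ
    have hi : M - τ < M := by omega
    have h1 := hyy ⟨M - τ, hi⟩
    have h2 := hJ2 ⟨M - τ, hi⟩
    have h3 := hey' (M - τ) hi.le
    simp only at h1 h2
    rw [show M - (M - τ) = τ by omega] at h2
    rw [← S.output_add, hzy _ hi, h1, show t - τ = s + (M - τ) by omega]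
    set σ := d.σy ⟨M - τ, hi⟩
    calc r₀ * ‖σ + hankelComb d.α ey (M - τ) - v (s + (M - τ))‖ * η ^ τ
        ≤ r₀ * (‖σ‖ + √p * (√q * J) + ‖v (s + (M - τ))‖) * (lam ^ τ * lam ^ τ) := by
          gcongr
          · exact (norm_sub_le _ _).trans (add_le_add_left ((norm_add_le _ _).trans
              (add_le_add_right h3 _)) _)
          · exact hηlam τ
      _ = r₀ * (‖σ‖ * lam ^ τ) * lam ^ τ
          + r₀ * (√p * (√q * J) + ‖v (s + (M - τ))‖) * lam ^ τ * lam ^ τ := by ring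
      _ ≤ r₀ * J * lam ^ τ
          + r₀ * (√p * (√q * J) + ‖v (s + (M - τ))‖) * lam ^ τ * 1 := by
          gcongr
          exact hlamτ τ
      _ = _ := by ring
  have hfin : ‖S.state x₀ u t - d.xbar (Fin.last M)‖
      ≤ ‖S.state x₀ u t - z M‖ + J + √q * J := by
    have h1 : S.state x₀ u t - d.xbar (Fin.last M) = (S.state x₀ u t - z M) + d.σx (Fin.last M)
        - hankelComb d.α ex M := by
      have := hzx (Fin.last M)
      rw [Fin.val_last] at this
      rw [this]
      abel
    rw [h1]
    exact (norm_sub_le _ _).trans (add_le_add ((norm_add_le _ _).trans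
      (add_le_add_right (hJ3 _) _)) (hex' M le_rfl))
  have hp : p₀ * ‖S.state x₀ u s - z 0‖ * η ^ M
      ≤ p₀ * (lam ^ M * ‖S.state x₀ u s - prior‖ + (2 + √q) * J) := by
    rw [mul_assoc]
    gcongr
  have hgain : p₀ * ((2 + √q) * J) + r₀ * (1 + √p * √q) * J * (1 / (1 - lam)) + J + √q * J
      ≤ costGain p p₀ r₀ lam * (1 + √q) * J := by
    have h1 : 0 < 1 - lam := by linarith
    have h2 : 0 ≤ r₀ * (√p + √q) / (1 - lam) := by positivity
    have h3 : costGain p p₀ r₀ lam * (1 + √q) * J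
        = (p₀ * ((2 + √q) * J) + r₀ * (1 + √p * √q) * J * (1 / (1 - lam)) + J + √q * J)
          + p₀ * √q * J + r₀ * (√p + √q) / (1 - lam) * J := by
      rw [costGain]
      field_simp
      ring
    rw [h3]
    have : 0 ≤ p₀ * √q * J := by positivity
    have : 0 ≤ r₀ * (√p + √q) / (1 - lam) * J := by positivity
    linarith
  nlinarith

/-- The true trajectory is feasible, with slack given by the online noise and by offline noise times
the bounded combination `α`; this bounds the optimal cost. -/
theorem exists_isFeasible_sqrt_cost_le (hS : S.IsControllable)
    (hlam0 : 0 < lam) (hlam1 : lam < 1) (hρ : W.ρ = lam ^ 2) {cP cR : ℝ} (hcP : 0 ≤ cP)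
    (hcR : 0 ≤ cR) (hP : ∀ x, wsq W.P x ≤ cP ^ 2 * ‖x‖ ^ 2)
    (hR : ∀ x, wsq W.R x ≤ cR ^ 2 * ‖x‖ ^ 2) (hσ : 0 ≤ W.cσ) (hα : 0 ≤ W.cα)
    {L N : ℕ} {ud : ℕ → Vec m} (hPE : IsPersistentlyExciting (L + n + 1) N ud) (xd₀ : Vec n)
    (hLN : L ≤ N) (β : ℝ) {M : ℕ} (hM : M ≤ L) :
    ∃ a : ℝ, 0 ≤ a ∧ ∀ {X : Set (Vec n)} {εx εy : ℝ≥0} {ex : ℕ → Vec n} {ey : ℕ → Vec p},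
      (∀ k < N, ∀ i, |ex k i| ≤ εx) → (∀ k < N, ∀ i, |ey k i| ≤ εy) →
      ∀ {x₀ : Vec n} {u : ℕ → Vec m} (v : ℕ → Vec p) {t : ℕ}, M ≤ t →
      (∀ t, S.state x₀ u t ∈ X) → (∀ t, ‖S.state x₀ u t‖ ≤ β) → (∀ t, ‖u t‖ ≤ β) →
      ∀ prior : Vec n, ∃ d : Decision n p M (N - M),
        d.IsFeasible ud (fun k => S.output xd₀ ud k + ey k)
          (fun k => S.state xd₀ ud k + ex k) X u (fun t => S.output x₀ u t + v t) t ∧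
        √(W.cost εx εy prior d) ≤ cP * lam ^ M * ‖S.state x₀ u (t - M) - prior‖
          + cR * ∑ τ ∈ Finset.Icc 1 M, ‖v (t - τ)‖ * lam ^ τ
          + a * (√(max εx εy : ℝ≥0) + (max εx εy : ℝ≥0)) := by
  obtain ⟨b, hb⟩ := LinSys.exists_bounded_combination hS hPE xd₀ β hM
  have hg1 : 0 ≤ (cR * (1 / (1 - lam)) * (√p * √N) + √W.cσ * ((M + 1) * (√n * √N))) * max b 0 := by
    have : 0 < 1 - lam := by linarith
    positivity
  have hg2 : 0 ≤ √(2 * W.cα) * max b 0 := by positivity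
  refine ⟨_, add_nonneg hg1 hg2, ?_⟩
  intro X εx εy ex ey hex hey x₀ u v t hMt hX hxβ huβ prior
  obtain ⟨α, hαb, hαu, hαx⟩ := hb (S.state x₀ u (t - M)) u (t - M) (hxβ _) huβ
  set s := t - M with hs
  have hαb' : ‖α‖ ≤ max b 0 := hαb.trans (le_max_left _ _)
  have hwin : ∀ i < M, hankelComb α ud i = u (s + i) := by
    intro i hi
    ext j
    have := congrFun hαu (⟨i, hi⟩, j)
    rwa [hankel_mulVec_apply] at this
  have hz0 : hankelComb α (S.state xd₀ ud) 0 = S.state x₀ u s := by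
    rw [← hαx, hankelComb]
    exact Finset.sum_congr rfl fun k _ => by rw [zero_add]
  have hzs := S.state_hankelComb α ud (fun j => u (s + j)) xd₀ hwin
  have hzy := S.output_hankelComb α ud (fun j => u (s + j)) xd₀ hwin
  rw [hz0] at hzs hzy
  set ε : ℝ := ((max εx εy : ℝ≥0) : ℝ) with hε
  have hε0 : 0 ≤ ε := (max εx εy).2
  have hεx : (εx : ℝ) ≤ ε := by exact_mod_cast le_max_left εx εy
  have hεy : (εy : ℝ) ≤ ε := by exact_mod_cast le_max_right εx εy
  have hcx : ∀ i ≤ M, ‖hankelComb α ex i‖ ≤ √n * √N * ε * max b 0 := fun i hi =>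
    (norm_hankelComb_le α ex εx.2 hex (by omega)).trans (by gcongr; exact hεx)
  have hcy : ∀ i ≤ M, ‖hankelComb α ey i‖ ≤ √p * √N * ε * max b 0 := fun i hi =>
    (norm_hankelComb_le α ey εy.2 hey (by omega)).trans (by gcongr; exact hεy)
  refine ⟨⟨fun i => S.state x₀ u (s + i), α, fun i => v (s + i) - hankelComb α ey i,
    fun i => hankelComb α ex i⟩, ?_, ?_⟩
  · rw [Decision.isFeasible_iff]
    refine ⟨fun i => hwin i i.2, fun i => ?_, fun i => ?_, fun i => hX _⟩
    · rw [hankelComb_add, ← hzy i i.2, ← S.output_add, ← hs]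
      simp only [add_sub_assoc, sub_sub_cancel]
    · rw [hankelComb_add, ← hzs i (by omega), ← S.state_add]
  refine (W.sqrt_cost_le hlam0 hρ hcP hcR hP hR hσ hα εx εy prior _).trans ?_
  have h1 : ∑ i : Fin M, ‖v (s + i) - hankelComb α ey i‖ * lam ^ (M - (i : ℕ))
      ≤ ∑ τ ∈ Finset.Icc 1 M, ‖v (t - τ)‖ * lam ^ τ
        + 1 / (1 - lam) * (√p * √N * ε * max b 0) := by
    have hle : ∑ i : Fin M, ‖v (s + i) - hankelComb α ey i‖ * lam ^ (M - (i : ℕ))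
        ≤ ∑ i : Fin M, (fun τ => (‖v (t - τ)‖ + √p * √N * ε * max b 0) * lam ^ τ) (M - i) := by
      refine Finset.sum_le_sum fun i _ => ?_
      simp only
      rw [show t - (M - (i : ℕ)) = s + i by omega]
      gcongr
      exact (norm_sub_le _ _).trans (add_le_add_right (hcy i i.2.le) _)
    refine hle.trans ?_
    rw [sum_fin_reflect M fun τ => (‖v (t - τ)‖ + √p * √N * ε * max b 0) * lam ^ τ]
    simp only [add_mul _ _ (lam ^ _), Finset.sum_add_distrib]
    rw [← Finset.mul_sum, mul_comm (1 / (1 - lam))]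
    gcongr
    exact sum_pow_le_inv hlam0.le hlam1 _
  have h2 : ∑ i : Fin (M + 1), ‖hankelComb α ex i‖ ≤ (M + 1) * (√n * √N * ε * max b 0) := by
    refine (Finset.sum_le_sum fun (i : Fin (M + 1)) _ => hcx i i.is_le).trans (le_of_eq ?_)
    simp
  have h3 : √(W.cα * ((εx : ℝ) + εy)) * ‖α‖ ≤ √(2 * W.cα) * max b 0 * √ε := by
    calc √(W.cα * ((εx : ℝ) + εy)) * ‖α‖ ≤ √(2 * W.cα * ε) * max b 0 :=
          mul_le_mul (Real.sqrt_le_sqrt (by nlinarith)) hαb' (norm_nonneg _) (Real.sqrt_nonneg _)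
      _ = _ := by rw [Real.sqrt_mul (by positivity)]; ring
  have h4 := mul_nonneg hg1 (Real.sqrt_nonneg ε)
  have h5 := mul_nonneg hg2 hε0
  have h1' := mul_le_mul_of_nonneg_left h1 hcR
  have h2' := mul_le_mul_of_nonneg_left h2 (Real.sqrt_nonneg W.cσ)
  simp only [Fin.val_zero, add_zero]
  nlinarith

end OneStep

/-! ### Iteration and practical robust exponential stability -/

theorem sum_Icc_add (f : ℕ → ℝ) (L s : ℕ) :
    ∑ τ ∈ Finset.Icc 1 (L + s), f τ
      = ∑ τ ∈ Finset.Icc 1 L, f τ + ∑ τ ∈ Finset.Icc 1 s, f (L + τ) := by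
  induction s with
  | zero => simp
  | succ s ih =>
    rw [← add_assoc, Finset.sum_Icc_succ_top (by omega), ih, Finset.sum_Icc_succ_top (by omega),
      add_assoc, add_assoc]

/-- An `L`-step contraction, together with bounds over the first `L` steps, gives an exponentially
discounted bound for all times. -/
theorem le_of_multistep_contraction {L : ℕ} (hL : 1 ≤ L) {e w : ℕ → ℝ} {μ c g : ℝ}
    (he : ∀ t, 0 ≤ e t) (hw : ∀ t, 0 ≤ w t) (hμ : 0 < μ) (hμL : 1 / 2 ≤ μ ^ L) (hc : 1 ≤ c)
    (hg : 0 ≤ g)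
    (h1 : ∀ t, 1 ≤ t → t < L →
      e t ≤ c * μ ^ t * e 0 + c * ∑ τ ∈ Finset.Icc 1 t, w (t - τ) * μ ^ τ + g)
    (h2 : ∀ t, L ≤ t →
      e t ≤ 1 / 2 * e (t - L) + c * ∑ τ ∈ Finset.Icc 1 L, w (t - τ) * μ ^ τ + g) (t : ℕ) :
    e t ≤ c * μ ^ t * e 0 + c * ∑ τ ∈ Finset.Icc 1 t, w (t - τ) * μ ^ τ + 2 * g := by
  induction t using Nat.strong_induction_on with
  | _ t ih =>
    rcases lt_or_ge t L with ht | ht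
    · rcases Nat.eq_zero_or_pos t with rfl | h0
      · have := he 0
        simp only [pow_zero, mul_one, zero_lt_one, Finset.Icc_eq_empty_of_lt, Finset.sum_empty,
          mul_zero, add_zero]
        nlinarith
      · linarith [h1 t h0 ht]
    · obtain ⟨s, rfl⟩ : ∃ s, t = L + s := ⟨t - L, by omega⟩
      have hs := ih s (by omega)
      have ht := h2 (L + s) ht
      rw [Nat.add_sub_cancel_left] at ht
      have hA : 0 ≤ c * μ ^ s * e 0 + c * ∑ τ ∈ Finset.Icc 1 s, w (s - τ) * μ ^ τ := by
        have h3 := he 0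
        have h4 : 0 ≤ ∑ τ ∈ Finset.Icc 1 s, w (s - τ) * μ ^ τ :=
          Finset.sum_nonneg fun τ _ => mul_nonneg (hw _) (by positivity)
        positivity
      have hB := mul_le_mul_of_nonneg_right hμL hA
      have hC : ∑ τ ∈ Finset.Icc 1 s, w (L + s - (L + τ)) * μ ^ (L + τ)
          = μ ^ L * ∑ τ ∈ Finset.Icc 1 s, w (s - τ) * μ ^ τ := by
        rw [Finset.mul_sum]
        refine Finset.sum_congr rfl fun τ _ => ?_
        rw [Nat.add_sub_add_left, pow_add]
        ring
      rw [sum_Icc_add, hC, pow_add]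
      linarith

/-- A decay rate that is slow enough both for the discount `lam` and for losing a factor `1 / 2`
every `L` steps. -/
theorem exists_le_and_half_le_pow {lam : ℝ} (h1 : lam < 1) {L : ℕ} (hL : 1 ≤ L) :
    ∃ μ, lam ≤ μ ∧ μ < 1 ∧ 1 / 2 ≤ μ ^ L := by
  refine ⟨max lam ((1 / 2 : ℝ) ^ ((L : ℝ)⁻¹)), le_max_left _ _, max_lt h1 ?_, ?_⟩
  · exact Real.rpow_lt_one (by norm_num) (by norm_num)
      (inv_pos.2 (by exact_mod_cast hL))
  · calc (1 / 2 : ℝ) = ((1 / 2 : ℝ) ^ ((L : ℝ)⁻¹)) ^ L :=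
          (Real.rpow_inv_natCast_pow (by norm_num) (by omega)).symm
      _ ≤ _ := by gcongr; exact le_max_right _ _

section

variable {m n p : ℕ} {S : LinSys m n p} {W : Weights n p}

/-- Controllability with `n > 0` forces at least one input, so that persistency of excitation
bounds the length of the data from below. -/
theorem lt_of_isPersistentlyExciting (hS : S.IsControllable) (hn : 0 < n) {L N : ℕ}
    {ud : ℕ → Vec m} (hPE : IsPersistentlyExciting (L + n + 1) N ud) : L < N := by
  have hm : 0 < m := by
    rcases Nat.eq_zero_or_pos m with rfl | hm
    · have h1 := hS
      rw [LinSys.IsControllable] at h1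
      have h2 := Matrix.rank_le_card_width
        (Matrix.of fun (i : Fin n) (kj : Fin n × Fin 0) => (S.A ^ (kj.1 : ℕ) * S.B) i kj.2)
      rw [h1] at h2
      simp at h2
      omega
    · exact hm
  have h2 := Matrix.rank_le_card_width (hankel (L + n + 1) (N + 1 - (L + n + 1)) ud)
  rw [hPE, Fintype.card_fin] at h2
  have h3 : 0 < m * (L + n + 1) := by positivity
  omega

/-- On a zero-dimensional state space the estimation error is zero. -/
theorem isPRES_of_subsingleton [Subsingleton (Vec n)] (L N : ℕ) (ud : ℕ → Vec m) (xd₀ : Vec n)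
    (U : Set (Vec m)) (Xt X : Set (Vec n)) (V : Set (Vec p)) (E : Set (ℝ≥0 × ℝ≥0)) :
    IsPRES S W L N ud xd₀ U Xt X V E := by
  refine ⟨1, 1, 1 / 2, 1 / 2, id, le_rfl, le_rfl, by norm_num, by norm_num,
    ⟨continuous_id, strictMono_id, rfl⟩, ?_⟩
  intro εx εy _ ex ey _ _ x₀ u v xhat _ _ _ _ _ _ t
  rw [Subsingleton.elim (S.state x₀ u t - xhat t) 0, norm_zero]
  have : 0 ≤ ∑ τ ∈ Finset.range (t + 1), 1 * ‖v (t - τ)‖ * (1 / 2 : ℝ) ^ τ :=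
    Finset.sum_nonneg fun τ _ => by positivity
  positivity

/-- If the constraint set is bounded, stability for all small offline noise bounds extends to all
offline noise bounds: for large noise the error is bounded by the diameter of the constraint set,
which a linear term in the gain function dominates. -/
theorem IsPRES.univ_of_isBounded {L N : ℕ} {ud : ℕ → Vec m} {xd₀ : Vec n}
    {U : Set (Vec m)} {Xt X : Set (Vec n)} {V : Set (Vec p)} {E : Set (ℝ≥0 × ℝ≥0)}
    (h : IsPRES S W L N ud xd₀ U Xt X V E) (hX : Xt ⊆ X) (hXb : Bornology.IsBounded X)
    {ε₀ : ℝ≥0} (hε₀ : 0 < ε₀) (hE : ∀ εx εy : ℝ≥0, max εx εy ≤ ε₀ → (εx, εy) ∈ E) :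
    IsPRES S W L N ud xd₀ U Xt X V Set.univ := by
  obtain ⟨c₁, c₂, lam₁, lam₂, γ, hc₁, hc₂, hlam₁, hlam₂, ⟨hγc, hγm, hγ0⟩, h⟩ := h
  obtain ⟨D, hD⟩ := hXb.exists_norm_le
  set k : ℝ≥0 := Real.toNNReal (2 * D) / ε₀ with hk
  refine ⟨c₁, c₂, lam₁, lam₂, fun s => γ s + k * s, hc₁, hc₂, hlam₁, hlam₂,
    ⟨by fun_prop, fun a b hab => ?_, by simp [hγ0]⟩, ?_⟩
  · exact add_lt_add_of_lt_of_le (hγm hab) (mul_le_mul_right hab.le k)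
  intro εx εy _ ex ey hex hey x₀ u v xhat hx₀ hxhat hu hx hv hest t
  push_cast
  rcases le_or_gt (max εx εy) ε₀ with hle | hgt
  · have h1 := h εx εy (hE _ _ hle) ex ey hex hey x₀ u v xhat hx₀ hxhat hu hx hv hest t
    have h2 : 0 ≤ (k : ℝ) * (max (εx : ℝ) εy) := by positivity
    linarith
  · have hmem : xhat t ∈ X := by
      rcases Nat.eq_zero_or_pos t with rfl | ht
      · exact hX hxhat
      · obtain ⟨d, hd, -, hlast⟩ := hest t ht
        rw [hlast]
        exact hd.2.2.2 _
    have h1 : ‖S.state x₀ u t - xhat t‖ ≤ 2 * D := by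
      have h2 := hD _ (hX (hx t))
      have h3 := hD _ hmem
      linarith [norm_sub_le (S.state x₀ u t) (xhat t)]
    have h2 : 2 * D ≤ k * (max (εx : ℝ) εy) := by
      have h3 : (ε₀ : ℝ) ≤ max (εx : ℝ) εy := by exact_mod_cast hgt.le
      have h4 : (0 : ℝ) < ε₀ := by exact_mod_cast hε₀
      calc 2 * D ≤ Real.toNNReal (2 * D) := Real.le_coe_toNNReal _
        _ = k * ε₀ := by rw [hk]; push_cast; field_simp
        _ ≤ _ := by gcongr
    have h5 : 0 ≤ c₁ * ‖x₀ - xhat 0‖ * lam₁ ^ t := by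
      have := hlam₁.1.le
      positivity
    have h6 : 0 ≤ ∑ τ ∈ Finset.range (t + 1), c₂ * ‖v (t - τ)‖ * lam₂ ^ τ :=
      Finset.sum_nonneg fun τ _ => by
        have := hlam₂.1.le
        positivity
    have h7 : (0 : ℝ) ≤ γ (max εx εy) := NNReal.coe_nonneg _
    linarith

/-- Stability for offline noise bounds on which the regularization weight is at most `Q²` and the
error contracts by `1 / 2` over a full horizon. -/
theorem isPRES_of_contraction {p₀ r₀ η lam cP cR Q : ℝ} (hS : S.IsControllable)
    (hE : S.IsEUOSS p₀ r₀ η)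
    (hlam0 : 0 < lam) (hlam1 : lam < 1) (hρ : W.ρ = lam ^ 2) (hη : η ≤ W.ρ)
    (hP : ∀ x, ‖x‖ ^ 2 ≤ wsq W.P x) (hR : ∀ x, ‖x‖ ^ 2 ≤ wsq W.R x)
    (hcP : 0 ≤ cP) (hcR : 0 ≤ cR) (hP' : ∀ x, wsq W.P x ≤ cP ^ 2 * ‖x‖ ^ 2)
    (hR' : ∀ x, wsq W.R x ≤ cR ^ 2 * ‖x‖ ^ 2) (hσ : 1 ≤ W.cσ)
    {L N : ℕ} (hL : 1 ≤ L) (hn : 0 < n) (hα : √n * √N ≤ W.cα) {ud : ℕ → Vec m}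
    (hPE : IsPersistentlyExciting (L + n + 1) N ud) (xd₀ : Vec n)
    {U : Set (Vec m)} {Xt X : Set (Vec n)} (V : Set (Vec p)) (hU : IsCompact U)
    (hXt : IsCompact Xt) (hX : Xt ⊆ X) {E : Set (ℝ≥0 × ℝ≥0)} (hQ0 : 0 ≤ Q)
    (hQ : ∀ ε ∈ E, √(W.cα * ((ε.1 : ℝ) + ε.2)) ≤ Q)
    (hcontr : ∀ ε ∈ E, (p₀ + costGain p p₀ r₀ lam * (1 + √(W.cα * ((ε.1 : ℝ) + ε.2))) * cP)
      * lam ^ L ≤ 1 / 2) :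
    IsPRES S W L N ud xd₀ U Xt X V E := by
  have hLN : L < N := lt_of_isPersistentlyExciting hS hn hPE
  have hα0 : 0 ≤ W.cα := le_trans (by positivity) hα
  obtain ⟨βU, hβU⟩ := hU.isBounded.exists_norm_le
  obtain ⟨βX, hβX⟩ := hXt.isBounded.exists_norm_le
  have hcand := fun (M : ℕ) (hM : M ≤ L) => exists_isFeasible_sqrt_cost_le hS hlam0 hlam1 hρ hcP
    hcR hP' hR' (by linarith) hα0 hPE xd₀ hLN.le (max βU βX) hM
  choose! a ha0 ha using hcand
  set A := ∑ M ∈ Finset.range (L + 1), a M with hA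
  have haA : ∀ M ≤ L, a M ≤ A := fun M hM =>
    Finset.single_le_sum (f := a) (fun i hi => ha0 i (by rw [Finset.mem_range] at hi; omega))
      (Finset.mem_range.2 (by omega))
  have hA0 : 0 ≤ A := (ha0 0 (by omega)).trans (haA 0 (by omega))
  obtain ⟨μ, hμlam, hμ1, hμL⟩ := exists_le_and_half_le_pow hlam1 hL
  have hμ0 : 0 < μ := hlam0.trans_le hμlam
  have hp₀ := hE.1
  have hr₀ := hE.2.1
  set c₀ := costGain p p₀ r₀ lam with hc₀
  have hc₀0 : 0 ≤ c₀ := by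
    have : 0 < 1 - lam := by linarith
    rw [hc₀, costGain]
    positivity
  set c := p₀ + c₀ * (1 + Q) * cP + r₀ + c₀ * (1 + Q) * cR with hc
  have hcp : p₀ + c₀ * (1 + Q) * cP ≤ c := by
    have : 0 ≤ c₀ * (1 + Q) * cR := by positivity
    linarith
  have hcr : r₀ + c₀ * (1 + Q) * cR ≤ c := by
    have : 0 ≤ c₀ * (1 + Q) * cP := by positivity
    linarith
  have hc1 : 1 ≤ c := by
    have : 0 ≤ c₀ * (1 + Q) * cP := by positivity
    linarith
  have hc0 : 0 ≤ c := by linarith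
  set k : ℝ≥0 := ⟨2 * (c₀ * (1 + Q) * A), by positivity⟩ with hk
  -- The summand `s` keeps the gain strictly increasing when `A = 0`.
  refine ⟨c, c, μ, μ, fun s => k * (NNReal.sqrt s + s) + s, hc1, hc1, ⟨hμ0, hμ1⟩, ⟨hμ0, hμ1⟩,
    ⟨by fun_prop, fun s s' hs => ?_, by simp⟩, ?_⟩
  · refine add_lt_add_of_le_of_lt (mul_le_mul_right (add_le_add ?_ hs.le) k) hs
    exact NNReal.sqrt_le_sqrt.2 hs.le
  intro εx εy hε ex ey hex hey x₀ u v xhat hx₀ hxhat hu hx hv hest t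
  have hQε := hQ _ hε
  have hcε := hcontr _ hε
  simp only at hQε hcε
  set ε : ℝ≥0 := max εx εy with hεdef
  set q := W.cα * ((εx : ℝ) + εy) with hq
  set e : ℕ → ℝ := fun t => ‖S.state x₀ u t - xhat t‖ with he
  set g : ℝ := c₀ * (1 + Q) * A * (√(ε : ℝ) + ε) with hg
  have hg0 : 0 ≤ g := by positivity
  -- one optimization step
  have step : ∀ t, 1 ≤ t → e t ≤
      (p₀ + c₀ * (1 + √q) * cP) * lam ^ (min t L) * e (t - min t L)
      + c * ∑ τ ∈ Finset.Icc 1 (min t L), ‖v (t - τ)‖ * μ ^ τ + g := by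
    intro t ht
    have hmin := hest t ht
    have hMt : min t L ≤ t := min_le_left _ _
    have hML : min t L ≤ L := min_le_right _ _
    generalize min t L = M at hmin hMt hML ⊢
    obtain ⟨d, hd, hopt, hlast⟩ := hmin
    have h1 := norm_state_sub_le_of_isFeasible hE hlam0 hlam1 hρ hη hP hR hσ hn hα hex hey hMt
      (show M + (N - M) ≤ N by omega) (xhat (t - M)) d hd
    obtain ⟨d', hd', h2⟩ := ha M hML hex hey v hMt (fun t => hX (hx t))
      (fun t => (hβX _ (hx t)).trans (le_max_right _ _))
      (fun t => (hβU _ (hu t)).trans (le_max_left _ _)) (xhat (t - M))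
    rw [← hlast] at h1
    have h3 := (Real.sqrt_le_sqrt (hopt d' hd')).trans h2
    set J := √(W.cost εx εy (xhat (t - M)) d)
    set w := ∑ τ ∈ Finset.Icc 1 M, ‖v (t - τ)‖ * lam ^ τ with hw
    have hw0 : 0 ≤ w := Finset.sum_nonneg fun τ _ => by positivity
    have hwμ : w ≤ ∑ τ ∈ Finset.Icc 1 M, ‖v (t - τ)‖ * μ ^ τ := by
      refine Finset.sum_le_sum fun τ _ => ?_
      gcongr
    have h4 := mul_le_mul_of_nonneg_left h3 (show 0 ≤ c₀ * (1 + √q) by positivity)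
    have h5 : c₀ * (1 + √q) * (a M * (√(ε : ℝ) + ε)) ≤ g := by
      rw [hg, mul_assoc _ A]
      have := ha0 M hML
      gcongr
      exact haA M hML
    have h6 : (r₀ + c₀ * (1 + √q) * cR) * w ≤ c * ∑ τ ∈ Finset.Icc 1 M, ‖v (t - τ)‖ * μ ^ τ := by
      refine mul_le_mul (le_trans ?_ hcr) hwμ hw0 hc0
      gcongr
    calc e t ≤ p₀ * lam ^ M * e (t - M) + r₀ * w + c₀ * (1 + √q) * J := h1
      _ ≤ p₀ * lam ^ M * e (t - M) + r₀ * w + c₀ * (1 + √q) * (cP * lam ^ M * e (t - M)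
          + cR * w + a M * (√(ε : ℝ) + ε)) := by linarith
      _ = (p₀ + c₀ * (1 + √q) * cP) * lam ^ M * e (t - M) + (r₀ + c₀ * (1 + √q) * cR) * w
          + c₀ * (1 + √q) * (a M * (√(ε : ℝ) + ε)) := by ring
      _ ≤ _ := by linarith
  have hfin := le_of_multistep_contraction hL (e := e) (w := fun t => ‖v t‖) (μ := μ) (c := c)
    (g := g) (fun t => norm_nonneg _) (fun t => norm_nonneg _) hμ0 hμL hc1 hg0
    (by
      intro t ht htL
      have := step t ht
      rw [min_eq_left htL.le, Nat.sub_self] at this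
      refine this.trans ?_
      have h1 : (p₀ + c₀ * (1 + √q) * cP) * lam ^ t ≤ c * μ ^ t := by
        refine mul_le_mul (le_trans ?_ hcp) (pow_le_pow_left₀ hlam0.le hμlam t) (by positivity) hc0
        gcongr
      have h2 := mul_le_mul_of_nonneg_right h1 (show 0 ≤ e 0 from norm_nonneg _)
      linarith)
    (by
      intro t ht
      have := step t (hL.trans ht)
      rw [min_eq_right ht] at this
      have h2 := mul_le_mul_of_nonneg_right hcε (show 0 ≤ e (t - L) from norm_nonneg _)
      linarith) t
  have hsum : c * ∑ τ ∈ Finset.Icc 1 t, ‖v (t - τ)‖ * μ ^ τ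
      ≤ ∑ τ ∈ Finset.range (t + 1), c * ‖v (t - τ)‖ * μ ^ τ := by
    rw [Finset.mul_sum]
    simp only [← mul_assoc]
    refine Finset.sum_le_sum_of_subset_of_nonneg (fun τ hτ => ?_) fun τ _ _ => by positivity
    rw [Finset.mem_Icc] at hτ
    rw [Finset.mem_range]
    omega
  have hγ : 2 * g ≤ ((k * (NNReal.sqrt ε + ε) + ε : ℝ≥0) : ℝ) := by
    have hε0 : (0 : ℝ) ≤ ε := ε.2
    have hkc : (k : ℝ) = 2 * (c₀ * (1 + Q) * A) := rfl
    rw [NNReal.coe_add, NNReal.coe_mul, NNReal.coe_add, Real.coe_sqrt, hkc, hg]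
    linarith
  have he0 : e 0 = ‖x₀ - xhat 0‖ := rfl
  rw [he0] at hfin
  have hcomm : c * μ ^ t * ‖x₀ - xhat 0‖ = c * ‖x₀ - xhat 0‖ * μ ^ t := by ring
  rw [hcomm] at hfin
  exact hfin.trans (add_le_add (add_le_add le_rfl hsum) hγ)

end

end

theorem theorem3 {m n p : ℕ} (S : LinSys m n p)
    (U : Set (Vec m)) (Xt X : Set (Vec n)) (V : Set (Vec p))
    (hctrl : S.IsControllable) (hdet : S.IsDetectable)
    (hU : IsCompact U) (hXt : IsCompact Xt) (hX : Xt ⊆ X) :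
    (∃ p₀ r₀ η : ℝ, S.IsEUOSS p₀ r₀ η) ∧
    ∀ p₀ r₀ η : ℝ, S.IsEUOSS p₀ r₀ η →
    ∀ (P : Matrix (Fin n) (Fin n) ℝ) (R : Matrix (Fin p) (Fin p) ℝ) (ρ cσ : ℝ)
      (hP : P.PosDef) (hR : R.PosDef),
      (∀ i, p₀ ≤ hP.isHermitian.eigenvalues i) → (∀ i, r₀ ≤ hR.isHermitian.eigenvalues i) →
      η ≤ ρ → ρ < 1 → p₀ ≤ cσ →
    ∃ (Lmin : ℕ) (δ : ℝ), 0 < δ ∧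
    ∀ L : ℕ, Lmin < L →
    ∀ (N : ℕ) (ud : ℕ → Vec m) (xd₀ : Vec n) (cα : ℝ),
      IsPersistentlyExciting (L + n + 1) N ud →
      max ((η - η ^ (L + 1)) / (1 - η) * r₀ * √(p : ℝ) * ((N : ℝ) - 1))
        (2 * p₀ * √((n : ℝ) * (N : ℝ))) ≤ cα →
      IsPRES S ⟨P, R, ρ, cσ, cα⟩ L N ud xd₀ U Xt X V
        {ε | cα * ((ε.1 : ℝ) + (ε.2 : ℝ)) * ρ ^ L ≤ δ} ∧
      (Bornology.IsBounded X →
        IsPRES S ⟨P, R, ρ, cσ, cα⟩ L N ud xd₀ U Xt X V Set.univ) := by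
  refine ⟨hdet.exists_isEUOSS, ?_⟩
  intro p₀ r₀ η hE P R ρ cσ hP hR hPeig hReig hηρ hρ1 hcσ
  obtain ⟨hp₀, hr₀, hη0, -, -⟩ := id hE
  rcases Nat.eq_zero_or_pos n with rfl | hn
  · exact ⟨0, 1, one_pos, fun L _ N ud xd₀ cα _ _ =>
      ⟨isPRES_of_subsingleton _ _ _ _ _ _ _ _ _, fun _ => isPRES_of_subsingleton _ _ _ _ _ _ _ _ _⟩⟩
  have hρ0 : 0 < ρ := hη0.trans_le hηρ
  set lam := √ρ with hlam
  have hlam0 : 0 < lam := Real.sqrt_pos.2 hρ0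
  have hlam1 : lam < 1 := by rw [hlam, Real.sqrt_lt' one_pos]; simpa using hρ1
  have hρlam : ρ = lam ^ 2 := (Real.sq_sqrt hρ0.le).symm
  obtain ⟨cP, hcP, hcP'⟩ := exists_wsq_le P
  obtain ⟨cR, hcR, hcR'⟩ := exists_wsq_le R
  have hPlow : ∀ x, ‖x‖ ^ 2 ≤ wsq P x := fun x => by
    simpa using le_wsq hP.isHermitian (c := 1) (fun i => hp₀.trans (hPeig i)) x
  have hRlow : ∀ x, ‖x‖ ^ 2 ≤ wsq R x := fun x => by
    simpa using le_wsq hR.isHermitian (c := 1) (fun i => hr₀.trans (hReig i)) x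
  set c₀ := costGain p p₀ r₀ lam with hc₀
  have hc₀0 : 0 ≤ c₀ := by
    have : 0 < 1 - lam := by linarith
    rw [hc₀, costGain]
    positivity
  -- The horizon and `δ` are chosen so that both parts of the contraction factor,
  -- `(p₀ + c₀ cP) lam ^ L` and `c₀ cP √δ`, are at most `1 / 4`.
  have hB : 0 < 4 * (p₀ + c₀ * cP) := by positivity
  obtain ⟨Lmin, hLmin⟩ := exists_pow_lt_of_lt_one (inv_pos.2 hB) hlam1
  have hs : 0 < (4 * (c₀ * cP + 1))⁻¹ := by positivity
  refine ⟨Lmin, ((4 * (c₀ * cP + 1))⁻¹) ^ 2, by positivity, ?_⟩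
  intro L hL N ud xd₀ cα hPE hcα
  have hLN : L < N := lt_of_isPersistentlyExciting hctrl hn hPE
  have hα : √n * √N ≤ cα := by
    refine le_trans ?_ ((le_max_right _ _).trans hcα)
    rw [Real.sqrt_mul (Nat.cast_nonneg _)]
    exact le_mul_of_one_le_left (by positivity) (by linarith)
  have hcα0 : 0 < cα := by
    have h1 : (0 : ℝ) < n := by exact_mod_cast hn
    have h2 : (0 : ℝ) < N := by exact_mod_cast (by omega : 0 < N)
    exact lt_of_lt_of_le (by positivity) hα
  set s := (4 * (c₀ * cP + 1))⁻¹ with hsdef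
  have hsmall : ∀ q : ℝ, 0 ≤ q → q * ρ ^ L ≤ s ^ 2 → √q * lam ^ L ≤ s := by
    intro q hq h
    refine abs_le_of_sq_le_sq' ?_ hs.le |>.2
    rw [mul_pow, Real.sq_sqrt hq, ← pow_mul, mul_comm L, pow_mul, ← hρlam]
    exact h
  have part1 : IsPRES S ⟨P, R, ρ, cσ, cα⟩ L N ud xd₀ U Xt X V
      {ε | cα * ((ε.1 : ℝ) + (ε.2 : ℝ)) * ρ ^ L ≤ s ^ 2} := by
    refine isPRES_of_contraction (W := ⟨P, R, ρ, cσ, cα⟩) (lam := lam) (cP := cP) (cR := cR)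
      (Q := s / lam ^ L) hctrl hE
      hlam0 hlam1 hρlam hηρ hPlow hRlow hcP hcR hcP' hcR' (hp₀.trans hcσ) (by omega) hn hα hPE xd₀
      V hU hXt hX (by positivity) ?_ ?_
    · intro ε hε
      rw [le_div_iff₀ (by positivity)]
      exact hsmall _ (by positivity) hε
    · intro ε hε
      have h1 := hsmall _ (by positivity) hε
      set r := √(cα * ((ε.1 : ℝ) + ε.2))
      have h2 : lam ^ L ≤ (4 * (p₀ + c₀ * cP))⁻¹ :=
        (pow_le_pow_of_le_one hlam0.le hlam1.le hL.le).trans hLmin.le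
      have h3 : (p₀ + c₀ * cP) * lam ^ L ≤ 1 / 4 := by
        calc (p₀ + c₀ * cP) * lam ^ L ≤ (p₀ + c₀ * cP) * (4 * (p₀ + c₀ * cP))⁻¹ := by gcongr
          _ = 1 / 4 := by field_simp
      have h4 : c₀ * cP * (r * lam ^ L) ≤ 1 / 4 := by
        calc c₀ * cP * (r * lam ^ L) ≤ (c₀ * cP + 1) * s := by gcongr; linarith
          _ = 1 / 4 := by rw [hsdef]; field_simp
      calc (p₀ + c₀ * (1 + r) * cP) * lam ^ L
          = (p₀ + c₀ * cP) * lam ^ L + c₀ * cP * (r * lam ^ L) := by ring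
        _ ≤ 1 / 2 := by linarith
  refine ⟨part1, fun hXb => ?_⟩
  have hε₀ : 0 < s ^ 2 / (2 * cα * ρ ^ L) := by positivity
  refine part1.univ_of_isBounded hX hXb (ε₀ := ⟨_, hε₀.le⟩) hε₀ ?_
  intro εx εy hmax
  have h1 : (εx : ℝ) ≤ s ^ 2 / (2 * cα * ρ ^ L) := (le_max_left εx εy).trans hmax
  have h2 : (εy : ℝ) ≤ s ^ 2 / (2 * cα * ρ ^ L) := (le_max_right εx εy).trans hmax
  calc cα * ((εx : ℝ) + εy) * ρ ^ L
      ≤ cα * (s ^ 2 / (2 * cα * ρ ^ L) + s ^ 2 / (2 * cα * ρ ^ L)) * ρ ^ L := by gcongr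
    _ = s ^ 2 := by field_simp; ring
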